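/- Let $M$ be a smooth manifold (Hausdorff, second countable, finite dimensional, possibly with boundary), let $k\in\mathbb N$ and $r\in\mathbb N\cup\{\infty\}$, and let $E^r=\mathcal C^r(M,\mathbb R^k)$ carry the weak Whitney topology (uniform convergence, on compact subsets of charts, of all derivatives of order at most $r$, of finite order if $r=\infty$). Let $X$ be a (centered) $\mathcal C^r$ Gaussian random field on $M$, defined on a probability space $(\Omega,\mathfrak S,\mathbb P)$: a measurable map $X\colon\Omega\to(\mathbb R^k)^M$ (product $\sigma$-algebra) such that $X\in E^r$ almost surely and such that for all $p_1,\dots,p_l\in M$ the vector $(X(p_1),\dots,X(p_l))$ is Gaussian with mean zero (and possibly degenerate). Let $K_X(p,q)=\mathbb E\{X(p)X(q)^T\}$ be its covariance function and let $$\mathrm{supp}(X)=\{f\in E^r:\ \mathbb P(X\in U)>0\text{ for every neighborhood }U\text{ of }f\text{ in }E^r\}$$ be its topological support. Then the following hold. 1. For all $p\in M$ and $j\in\{1,\dots,k\}$ the function $h_p^j\colon q\mapsto K_X(q,p)e_j$ belongs to $E^r$, and $$\mathrm{supp}(X)=\overline{\mathrm{span}\{h_p^j:\ p\in M,\ j=1,\dots,k\}}^{E^r}.$$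 2. Let $\Gamma_X=\overline{\mathrm{span}\{X^j(p):\ p\in M,\ j=1,\dots,k\}}^{L^2(\Omega,\mathfrak S,\mathbb P)}$ and, for $\gamma\in\Gamma_X$, let $\rho_X(\gamma)\colon M\to\mathbb R^k$ be the function $q\mapsto\mathbb E\{X(q)\gamma\}$. Then $\rho_X(\gamma)\in E^r$ for every $\gamma\in\Gamma_X$, and, with $\mathcal H_X=\rho_X(\Gamma_X)\subset E^r$ the Cameron–Martin space of $X$, $$\mathrm{supp}(X)=\overline{\mathcal H_X}^{E^r}.$$ 3. If $\{f_n\}_{n\in\mathbb N}\subset E^r$ and $\{\xi_n\}_{n\in\mathbb N}$ is a sequence of independent standard Gaussian random variables on $(\Omega,\mathfrak S,\mathbb P)$ such that the series $\sum_{n}\xi_nf_n$ converges in $E^r$ to $X$ almost surely, then $$\mathrm{supp}(X)=\overline{\mathrm{span}\{f_n\}_{n\in\mathbb N}}^{E^r}.$$ -/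

import Mathlib

open MeasureTheory ProbabilityTheory Filter Topology
open scoped Manifold ContDiff

noncomputable section

namespace GaussianRandomField

section WhitneyTopology

variable {E : Type*} [NormedAddCommGroup E] [NormedSpace ℝ E]
  {H : Type*} [TopologicalSpace H] (I : ModelWithCorners ℝ E H)
  {M : Type*} [TopologicalSpace M] [ChartedSpace H M]
  {V : Type*} [NormedAddCommGroup V] [NormedSpace ℝ V]

/-- The `i`-th derivative of `f : M → V` read in the chart `e`, as a function on the target of the
(extended) chart. At boundary points the derivative is taken within the target of the chart. -/
def chartDeriv (e : OpenPartialHomeomorph M H) (i : ℕ) (f : M → V) :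
    E → ContinuousMultilinearMap ℝ (fun _ : Fin i => E) V :=
  iteratedFDerivWithin ℝ i (f ∘ (e.extend I).symm) (e.extend I).target

/-- The weak Whitney topology on `C^r(M, V)`, where `r` is a natural number or `∞`: the coarsest
topology for which, for every chart `e` of the smooth structure of `M` and every finite `i ≤ r`,
the map sending `f` to the `i`-th derivative of `f` in the chart `e` is continuous for the
topology of uniform convergence on the compact subsets of the target of the chart. -/
instance weakWhitneyTopology (r : ℕ∞) : TopologicalSpace C^r⟮I, M; 𝓘(ℝ, V), V⟯ :=
  ⨅ (e : OpenPartialHomeomorph M H) (_ : e ∈ IsManifold.maximalAtlas I ∞ M)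
    (i : ℕ) (_ : (i : ℕ∞) ≤ r),
    TopologicalSpace.induced
      (fun f : C^r⟮I, M; 𝓘(ℝ, V), V⟯ =>
        UniformOnFun.ofFun {K : Set E | IsCompact K ∧ K ⊆ (e.extend I).target}
          (chartDeriv I e i f))
      inferInstance

end WhitneyTopology

section Fields

variable {E : Type*} [NormedAddCommGroup E] [NormedSpace ℝ E]
  {H : Type*} [TopologicalSpace H] (I : ModelWithCorners ℝ E H)
  {M : Type*} [TopologicalSpace M] [ChartedSpace H M]
  {Ω : Type*} [MeasurableSpace Ω] {k : ℕ}

/-- `X` is a (centered) `C^r` Gaussian random field on `M` with values in `ℝ^k`, defined on the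
probability space `(Ω, P)`. -/
structure IsGaussianRandomField (r : ℕ∞) (X : M → Ω → EuclideanSpace ℝ (Fin k))
    (P : Measure Ω) : Prop where
  measurable : ∀ p, Measurable (X p)
  ae_contMDiff : ∀ᵐ w ∂P, ContMDiff I 𝓘(ℝ, EuclideanSpace ℝ (Fin k)) r (fun p => X p w)
  gaussian : IsGaussianProcess X P
  centered : ∀ p, ∫ w, X p w ∂P = 0

/-- The topological support of the random field `X` in `C^r(M, ℝ^k)`: the set of those `f` such
that `P {X ∈ U} > 0` for every neighbourhood `U` of `f`. -/
def fieldSupport (r : ℕ∞) (X : M → Ω → EuclideanSpace ℝ (Fin k)) (P : Measure Ω) :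
    Set C^r⟮I, M; 𝓘(ℝ, EuclideanSpace ℝ (Fin k)), EuclideanSpace ℝ (Fin k)⟯ :=
  {f | ∀ U ∈ 𝓝 f, 0 < P {w | ∃ g ∈ U, ∀ p, g p = X p w}}

/-- The covariance function `K_X(p, q) = 𝔼[X(p) X(q)ᵀ]`. -/
def covFun (X : M → Ω → EuclideanSpace ℝ (Fin k)) (P : Measure Ω) (p q : M) :
    Matrix (Fin k) (Fin k) ℝ :=
  Matrix.of fun i j => ∫ w, X p w i * X q w j ∂P

/-- The function `h_p^j : q ↦ K_X(q, p) e_j`, the `j`-th column of `K_X(q, p)`. -/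
def covColumn (X : M → Ω → EuclideanSpace ℝ (Fin k)) (P : Measure Ω) (p : M) (j : Fin k) :
    M → EuclideanSpace ℝ (Fin k) :=
  fun q => WithLp.toLp 2 fun i => covFun X P q p i j

/-- The Gaussian Hilbert space `Γ_X`: the closure in `L²(Ω, P)` of the span of the real random
variables `X^j(p)`. -/
def gaussianSpace (X : M → Ω → EuclideanSpace ℝ (Fin k)) (P : Measure Ω) :
    Submodule ℝ (Lp ℝ 2 P) :=
  (Submodule.span ℝ
    {γ : Lp ℝ 2 P | ∃ (p : M) (j : Fin k), γ =ᵐ[P] fun w => X p w j}).topologicalClosure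

/-- The function `ρ_X(γ) = 𝔼[X(·) γ]` on `M`, for `γ ∈ L²(Ω, P)`. -/
def cameronMartinFun (X : M → Ω → EuclideanSpace ℝ (Fin k)) (P : Measure Ω) (γ : Lp ℝ 2 P) :
    M → EuclideanSpace ℝ (Fin k) :=
  fun q => WithLp.toLp 2 fun i => ∫ w, X q w i * γ w ∂P

/-- The Cameron–Martin space `H_X` of the random field `X`, as a subset of `C^r(M, ℝ^k)`: the image
of the Gaussian Hilbert space `Γ_X` under `ρ_X`. -/
def cameronMartinSpace (r : ℕ∞) (X : M → Ω → EuclideanSpace ℝ (Fin k)) (P : Measure Ω) :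
    Set C^r⟮I, M; 𝓘(ℝ, EuclideanSpace ℝ (Fin k)), EuclideanSpace ℝ (Fin k)⟯ :=
  {f | ∃ γ ∈ gaussianSpace X P, ∀ q, f q = cameronMartinFun X P γ q}

end Fields

end GaussianRandomField

end

noncomputable section

namespace GaussianRandomField

section GaussianHilbert

variable {Ω : Type*} [MeasurableSpace Ω] {P : Measure Ω}

/-- A subspace of `L²` all of whose elements have the characteristic function of a centered
Gaussian variable. -/
def IsGaussianSubspace (G : Submodule ℝ (Lp ℝ 2 P)) : Prop :=
  ∀ γ ∈ G, ∫ w, Complex.exp (γ w * Complex.I) ∂P = Complex.exp (-(‖γ‖ : ℂ) ^ 2 / 2)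

/-- The random variable `Z` represents an element of `G`. -/
def AEMem (G : Submodule ℝ (Lp ℝ 2 P)) (Z : Ω → ℝ) : Prop :=
  ∃ γ ∈ G, Z =ᵐ[P] γ

variable {G : Submodule ℝ (Lp ℝ 2 P)}

lemma AEMem.congr {Y Z : Ω → ℝ} (hY : AEMem G Y) (h : Z =ᵐ[P] Y) : AEMem G Z := by
  obtain ⟨γ, hγ, e⟩ := hY
  exact ⟨γ, hγ, h.trans e⟩

lemma AEMem.zero : AEMem G (fun _ => 0) :=
  ⟨0, G.zero_mem, (Lp.coeFn_zero ℝ 2 P).symm⟩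

lemma AEMem.add {Y Z : Ω → ℝ} (hY : AEMem G Y) (hZ : AEMem G Z) :
    AEMem G (fun w => Y w + Z w) := by
  obtain ⟨γ, hγ, e⟩ := hY
  obtain ⟨δ, hδ, e'⟩ := hZ
  refine ⟨γ + δ, G.add_mem hγ hδ, ?_⟩
  filter_upwards [e, e', Lp.coeFn_add γ δ] with w h1 h2 h3
  rw [h3, Pi.add_apply, h1, h2]

lemma AEMem.const_mul {Y : Ω → ℝ} (hY : AEMem G Y) (c : ℝ) :
    AEMem G (fun w => c * Y w) := by
  obtain ⟨γ, hγ, e⟩ := hY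
  refine ⟨c • γ, G.smul_mem c hγ, ?_⟩
  filter_upwards [e, Lp.coeFn_smul c γ] with w h1 h3
  rw [h3, Pi.smul_apply, h1, smul_eq_mul]

lemma AEMem.sub {Y Z : Ω → ℝ} (hY : AEMem G Y) (hZ : AEMem G Z) :
    AEMem G (fun w => Y w - Z w) :=
  (hY.add (hZ.const_mul (-1))).congr (.of_forall fun w => by ring)

lemma AEMem.sum {ι : Type*} (s : Finset ι) {Y : ι → Ω → ℝ} (hY : ∀ i ∈ s, AEMem G (Y i)) :
    AEMem G (fun w => ∑ i ∈ s, Y i w) := by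
  classical
  induction s using Finset.induction_on with
  | empty => simpa using AEMem.zero
  | insert a s ha ih =>
    simp only [Finset.sum_insert ha]
    exact (hY a (by simp)).add (ih fun i hi => hY i (by simp [hi]))

lemma AEMem.aestronglyMeasurable {Y : Ω → ℝ} (hY : AEMem G Y) : AEStronglyMeasurable Y P := by
  obtain ⟨γ, _, e⟩ := hY
  exact (Lp.aestronglyMeasurable γ).congr e.symm

lemma AEMem.memLp {Y : Ω → ℝ} (hY : AEMem G Y) : MemLp Y 2 P := by
  obtain ⟨γ, _, e⟩ := hY
  exact (memLp_congr_ae e).2 (Lp.memLp γ)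

lemma tendsto_integral_cexp [IsFiniteMeasure P] {ι : Type*} {l : Filter ι} [l.IsCountablyGenerated]
    {Z : ι → Ω → ℝ} {Y : Ω → ℝ} (hZ : ∀ i, AEStronglyMeasurable (Z i) P)
    (h : ∀ᵐ w ∂P, Tendsto (fun i => Z i w) l (𝓝 (Y w))) :
    Tendsto (fun i => ∫ w, Complex.exp (Z i w * Complex.I) ∂P) l
      (𝓝 (∫ w, Complex.exp (Y w * Complex.I) ∂P)) := by
  refine tendsto_integral_filter_of_dominated_convergence (fun _ => 1) ?_ ?_
    (integrable_const 1) ?_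
  · refine .of_forall fun i => ?_
    exact (by fun_prop : Continuous fun x : ℝ => Complex.exp (x * Complex.I)).comp_aestronglyMeasurable
      (hZ i)
  · exact .of_forall fun i => .of_forall fun w => (Complex.norm_exp_ofReal_mul_I _).le
  · filter_upwards [h] with w hw
    exact ((by fun_prop : Continuous fun x : ℝ => Complex.exp (x * Complex.I)).tendsto _).comp hw

lemma IsGaussianSubspace.topologicalClosure [IsFiniteMeasure P] (hG : IsGaussianSubspace G) :
    IsGaussianSubspace G.topologicalClosure := by
  intro γ hγ
  obtain ⟨u, hu, hlim⟩ := mem_closure_iff_seq_limit.1 hγ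
  obtain ⟨ns, hns, hae⟩ := (tendstoInMeasure_of_tendsto_Lp hlim).exists_seq_tendsto_ae
  have h1 := tendsto_integral_cexp (fun i => Lp.aestronglyMeasurable (u (ns i))) hae
  have h2 : Tendsto (fun i => Complex.exp (-(‖u (ns i)‖ : ℂ) ^ 2 / 2)) atTop
      (𝓝 (Complex.exp (-(‖γ‖ : ℂ) ^ 2 / 2))) := by
    have : Continuous fun x : Lp ℝ 2 P => Complex.exp (-(‖x‖ : ℂ) ^ 2 / 2) := by fun_prop
    exact (this.tendsto γ).comp (hlim.comp hns.tendsto_atTop)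
  refine tendsto_nhds_unique h1 (h2.congr fun i => ?_)
  exact (hG _ (hu (ns i))).symm

lemma AEMem.of_tendsto [IsProbabilityMeasure P] (hG : IsGaussianSubspace G)
    (hc : IsClosed (G : Set (Lp ℝ 2 P))) {Z : ℕ → Ω → ℝ} {Y : Ω → ℝ}
    (hZ : ∀ n, AEMem G (Z n)) (h : ∀ᵐ w ∂P, Tendsto (fun n => Z n w) atTop (𝓝 (Y w))) :
    AEMem G Y := by
  choose γ hγ e using hZ
  have hae : ∀ᵐ w ∂P, Tendsto (fun n => γ n w) atTop (𝓝 (Y w)) := by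
    filter_upwards [h, ae_all_iff.2 e] with w hw hew
    exact hw.congr hew
  have h1 : Tendsto (fun n : ℕ × ℕ => ∫ w, Complex.exp ((γ n.1 - γ n.2 : Lp ℝ 2 P) w * Complex.I) ∂P)
      atTop (𝓝 (∫ w, Complex.exp (((0 : ℝ) : ℂ) * Complex.I) ∂P)) := by
    refine tendsto_integral_cexp (fun i => Lp.aestronglyMeasurable _) ?_
    have hs : ∀ᵐ w ∂P, ∀ n : ℕ × ℕ, (γ n.1 - γ n.2 : Lp ℝ 2 P) w = γ n.1 w - γ n.2 w :=
      ae_all_iff.2 fun n => Lp.coeFn_sub _ _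
    filter_upwards [hae, hs] with w hw hws
    have h0 : Tendsto (fun n : ℕ × ℕ => γ n.1 w - γ n.2 w) atTop (𝓝 (Y w - Y w)) := by
      rw [← prod_atTop_atTop_eq]
      exact (hw.comp tendsto_fst).sub (hw.comp tendsto_snd)
    rw [sub_self] at h0
    exact h0.congr fun n => (hws n).symm
  have h2 : Tendsto (fun n : ℕ × ℕ => Real.exp (-‖γ n.1 - γ n.2‖ ^ 2 / 2)) atTop (𝓝 1) := by
    have := h1.norm
    simp only [Complex.ofReal_zero, zero_mul, Complex.exp_zero, integral_const, probReal_univ,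
      one_smul, norm_one] at this
    refine this.congr fun n => ?_
    rw [hG _ (G.sub_mem (hγ _) (hγ _)), Complex.norm_exp]
    norm_cast
  have h3 : Tendsto (fun n : ℕ × ℕ => dist (γ n.1) (γ n.2)) atTop (𝓝 0) := by
    have h4 := (Real.continuousAt_log one_ne_zero).tendsto.comp h2
    have h5 := ((h4.const_mul (-2)).sqrt)
    rw [Real.log_one, mul_zero, Real.sqrt_zero] at h5
    refine h5.congr fun n => ?_
    rw [Function.comp, Real.log_exp, dist_eq_norm,
      show -2 * (-‖γ n.1 - γ n.2‖ ^ 2 / 2) = ‖γ n.1 - γ n.2‖ ^ 2 by ring,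
      Real.sqrt_sq (norm_nonneg _)]
  obtain ⟨δ, hδ⟩ := cauchySeq_tendsto_of_complete (cauchySeq_iff_tendsto_dist_atTop_0.2 h3)
  obtain ⟨ns, hns, hae'⟩ := (tendstoInMeasure_of_tendsto_Lp hδ).exists_seq_tendsto_ae
  refine ⟨δ, hc.mem_of_tendsto hδ (.of_forall hγ), ?_⟩
  filter_upwards [hae, hae'] with w hw hw'
  exact tendsto_nhds_unique (hw.comp hns.tendsto_atTop) hw'

lemma AEMem.integral_cexp (hG : IsGaussianSubspace G) {Y : Ω → ℝ} (hY : AEMem G Y) :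
    ∫ w, Complex.exp (Y w * Complex.I) ∂P = Complex.exp (-((∫ w, Y w ^ 2 ∂P : ℝ) : ℂ) / 2) := by
  obtain ⟨γ, hγ, e⟩ := hY
  have h1 : ∫ w, Y w ^ 2 ∂P = ‖γ‖ ^ 2 := by
    rw [← real_inner_self_eq_norm_sq, L2.inner_def]
    refine integral_congr_ae ?_
    filter_upwards [e] with w hw
    rw [hw, real_inner_self_eq_norm_sq, Real.norm_eq_abs, sq_abs]
  rw [h1, Complex.ofReal_pow, ← hG γ hγ]
  refine integral_congr_ae ?_
  filter_upwards [e] with w hw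
  rw [hw]

lemma AEMem.hasLaw [IsProbabilityMeasure P] (hG : IsGaussianSubspace G) {Y : Ω → ℝ}
    (hY : AEMem G Y) : HasLaw Y (gaussianReal 0 (∫ w, Y w ^ 2 ∂P).toNNReal) P := by
  have hm : AEMeasurable Y P := hY.aestronglyMeasurable.aemeasurable
  refine ⟨hm, ?_⟩
  have : IsProbabilityMeasure (P.map Y) := Measure.isProbabilityMeasure_map hm
  refine Measure.ext_of_charFun (funext fun t => ?_)
  rw [charFun_gaussianReal, charFun_apply_real, integral_map hm (by fun_prop)]
  have := (hY.const_mul t).integral_cexp hG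
  push_cast at this
  rw [this]
  congr 1
  simp only [mul_pow, integral_const_mul]
  rw [Real.coe_toNNReal _ (integral_nonneg fun w => sq_nonneg _)]
  push_cast
  ring

lemma isGaussianSubspace_span [IsProbabilityMeasure P] {T : Type*} {Z : T → Ω → ℝ}
    (hZ : IsGaussianProcess Z P) (h0 : ∀ t, ∫ w, Z t w ∂P = 0) :
    IsGaussianSubspace (Submodule.span ℝ {γ : Lp ℝ 2 P | ∃ t, γ =ᵐ[P] Z t}) := by
  intro γ hγ
  obtain ⟨n, c, g, rfl⟩ := Submodule.mem_span_set'.1 hγ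
  choose t ht using fun i => (g i).2
  set γ : Lp ℝ 2 P := ∑ i, c i • (g i : Lp ℝ 2 P)
  have e : γ =ᵐ[P] fun w => ∑ i, c i • Z (t i) w := by
    have h1 : ∀ᵐ w ∂P, ∀ i, (c i • (g i : Lp ℝ 2 P) : Lp ℝ 2 P) w = c i • Z (t i) w := by
      refine ae_all_iff.2 fun i => ?_
      filter_upwards [Lp.coeFn_smul (c i) (g i : Lp ℝ 2 P), ht i] with w h1 h2
      rw [h1, Pi.smul_apply, h2]
    filter_upwards [h1, Lp.coeFn_finsetSum Finset.univ fun i => c i • (g i : Lp ℝ 2 P)]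
      with w h1 h2
    rw [h2, Finset.sum_apply]
    exact Finset.sum_congr rfl fun i _ => h1 i
  have h1 : HasGaussianLaw (fun w => ∑ i, c i • Z (t i) w) P :=
    ((hZ.comp_right t).smul c).hasGaussianLaw_fun_sum
  have h2 : HasGaussianLaw γ P := h1.congr e.symm
  have h3 : ∫ w, γ w ∂P = 0 := by
    rw [integral_congr_ae e, integral_finsetSum]
    · simp [integral_const_mul, h0]
    · intro i _
      exact ((hZ.hasGaussianLaw_eval (t i)).integrable).smul (c i)
  have h4 := h2.charFun_map_eq 1
  rw [charFun_apply_real, integral_map h2.aemeasurable (by fun_prop)] at h4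
  simp only [Complex.ofReal_one, one_mul] at h4
  rw [h4]
  have h5 : ∀ x : ℝ, inner ℝ (1 : ℝ) x = x := by simp
  simp only [h5, h3]
  rw [variance_of_integral_eq_zero h2.aemeasurable h3]
  have h6 : ∫ w, γ w ^ 2 ∂P = ‖γ‖ ^ 2 := by
    rw [← real_inner_self_eq_norm_sq, L2.inner_def]
    simp
  simp [h6, neg_div]

end GaussianHilbert

section Support

lemma exists_dual_eq_zero_of_notMem_closure {B : Type*} [NormedAddCommGroup B] [NormedSpace ℝ B]
    (T : Submodule ℝ B) {b : B} (hb : b ∉ closure (T : Set B)) :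
    ∃ ℓ : StrongDual ℝ B, (∀ x ∈ T, ℓ x = 0) ∧ ℓ b ≠ 0 := by
  obtain ⟨ℓ, u, h1, h2⟩ := geometric_hahn_banach_point_closed
    (T.convex.closure) isClosed_closure hb
  have h3 : ∀ x ∈ T, ℓ x = 0 := by
    intro x hx
    by_contra hne
    have := h2 _ (subset_closure (T.smul_mem ((u - 1) / ℓ x) hx))
    rw [map_smul, smul_eq_mul, div_mul_cancel₀ _ hne] at this
    linarith
  refine ⟨ℓ, h3, ?_⟩
  have := h2 0 (subset_closure T.zero_mem)
  rw [map_zero] at this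
  linarith

section Gaussian

variable {B : Type*} [NormedAddCommGroup B] [NormedSpace ℝ B] [CompleteSpace B]
  [SecondCountableTopology B] [MeasurableSpace B] [BorelSpace B] {μ : Measure B} [IsGaussian μ]

lemma cos_smul_add_sin_smul_mem_support (h0 : ∀ L : StrongDual ℝ B, μ[L] = 0) (θ : ℝ) {f g : B}
    (hf : f ∈ μ.support) (hg : g ∈ μ.support) :
    Real.cos θ • f + Real.sin θ • g ∈ μ.support := by
  rw [Measure.support_eq_forall_isOpen] at *
  intro U hU hUo
  have h1 : μ U = (μ.prod μ) ((fun x : B × B => Real.cos θ • x.1 + Real.sin θ • x.2) ⁻¹' U) := by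
    calc μ U = (μ.prod μ) (Prod.fst ⁻¹' U) := by
            rw [show (Prod.fst ⁻¹' U : Set (B × B)) = U ×ˢ Set.univ by ext; simp,
              Measure.prod_prod, measure_univ, mul_one]
      _ = ((μ.prod μ).map (ContinuousLinearMap.rotation θ)) (Prod.fst ⁻¹' U) := by
            rw [IsGaussian.map_rotation_eq_self_of_forall_strongDual_eq_zero h0]
      _ = _ := by
            rw [Measure.map_apply (by fun_prop) (hUo.measurableSet.preimage measurable_fst)]
            rfl
  rw [h1]
  have h2 : IsOpen ((fun x : B × B => Real.cos θ • x.1 + Real.sin θ • x.2) ⁻¹' U) :=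
    hUo.preimage (by fun_prop)
  obtain ⟨V, W, hV, hW, hfV, hgW, hVW⟩ := isOpen_prod_iff.1 h2 f g hU
  refine lt_of_lt_of_le ?_ (measure_mono hVW)
  rw [Measure.prod_prod]
  exact ENNReal.mul_pos (hf V hfV hV).ne' (hg W hgW hW).ne'

/-- The support of a centered Gaussian measure is a linear subspace. -/
def supportSubmodule (h0 : ∀ L : StrongDual ℝ B, μ[L] = 0) : Submodule ℝ B :=
  have hneg : ∀ f ∈ μ.support, -f ∈ μ.support := fun f hf => by
    simpa using cos_smul_add_sin_smul_mem_support h0 Real.pi hf hf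
  have hzero : (0 : B) ∈ μ.support := by
    obtain ⟨f, hf⟩ := Measure.nonempty_support (NeZero.ne μ)
    simpa using cos_smul_add_sin_smul_mem_support h0 (Real.pi / 4) hf (hneg f hf)
  have hcontr : ∀ c : ℝ, |c| ≤ 1 → ∀ f ∈ μ.support, c • f ∈ μ.support := fun c hc f hf => by
    have := cos_smul_add_sin_smul_mem_support h0 (Real.arccos c) hf hzero
    rwa [smul_zero, add_zero, Real.cos_arccos (abs_le.1 hc).1 (abs_le.1 hc).2] at this
  have hsqrt : ∀ f ∈ μ.support, √2 • f ∈ μ.support := fun f hf => by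
    have := cos_smul_add_sin_smul_mem_support h0 (Real.pi / 4) hf hf
    rw [Real.cos_pi_div_four, Real.sin_pi_div_four, ← add_smul] at this
    simpa using this
  have hpow : ∀ n : ℕ, ∀ f ∈ μ.support, (√2 ^ n) • f ∈ μ.support := fun n => by
    induction n with
    | zero => simp
    | succ n ih => exact fun f hf => by rw [pow_succ', mul_smul]; exact hsqrt _ (ih f hf)
  { carrier := μ.support
    zero_mem' := hzero
    add_mem' := fun {f g} hf hg => by
      have := hsqrt _ (cos_smul_add_sin_smul_mem_support h0 (Real.pi / 4) hf hg)
      rw [Real.cos_pi_div_four, Real.sin_pi_div_four, ← smul_add, smul_smul] at this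
      rwa [show √2 * (√2 / 2) = 1 by rw [← mul_div_assoc, Real.mul_self_sqrt] <;> norm_num,
        one_smul] at this
    smul_mem' := fun c f hf => by
      obtain ⟨n, hn⟩ := pow_unbounded_of_one_lt |c| (Real.lt_sqrt_of_sq_lt (by norm_num) : 1 < √2)
      have hp : 0 < √2 ^ n := by positivity
      have := hcontr (c / √2 ^ n) (by
        rw [abs_div, abs_of_pos hp]; exact (div_le_one hp).2 hn.le) _ (hpow n f hf)
      rwa [smul_smul, div_mul_cancel₀ _ hp.ne'] at this }

lemma support_eq_closure_of_annihilator (h0 : ∀ L : StrongDual ℝ B, μ[L] = 0)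
    (T : Submodule ℝ B)
    (hT : ∀ ℓ : StrongDual ℝ B, (∀ᵐ b ∂μ, ℓ b = 0) ↔ ∀ x ∈ T, ℓ x = 0) :
    μ.support = closure (T : Set B) := by
  refine Set.Subset.antisymm (fun b hb => ?_) (closure_minimal (fun b hb => ?_)
    Measure.isClosed_support)
  · by_contra hbT
    obtain ⟨ℓ, h1, h2⟩ := exists_dual_eq_zero_of_notMem_closure T hbT
    have hcl : IsClosed {x : B | ℓ x = 0} := isClosed_eq ℓ.continuous continuous_const
    exact h2 (Measure.support_subset_of_isClosed hcl ((hT ℓ).2 h1) hb)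
  · by_contra hbS
    obtain ⟨ℓ, h1, h2⟩ := exists_dual_eq_zero_of_notMem_closure (supportSubmodule h0) (b := b) (by
      change b ∉ closure μ.support
      rwa [Measure.isClosed_support.closure_eq])
    refine h2 ((hT ℓ).1 ?_ b hb)
    filter_upwards [Measure.support_mem_ae (μ := μ)] with x hx
    exact h1 x hx

end Gaussian

section Field

variable {Ω : Type*} [MeasurableSpace Ω] {P : Measure Ω} [IsProbabilityMeasure P]
  {G : Submodule ℝ (Lp ℝ 2 P)}

lemma hasGaussianLaw_of_aemem {B : Type*} [NormedAddCommGroup B] [NormedSpace ℝ B]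
    [MeasurableSpace B] [BorelSpace B] (hG : IsGaussianSubspace G) {Y : Ω → B}
    (hY : AEMeasurable Y P) (hm : ∀ ℓ : StrongDual ℝ B, AEMem G (fun w => ℓ (Y w))) :
    HasGaussianLaw Y P := by
  refine ⟨isGaussian_of_map_eq_gaussianReal fun ℓ => ?_⟩
  have h1 := ((hm ℓ).hasLaw hG).map_eq
  rw [AEMeasurable.map_map_of_aemeasurable (by fun_prop) hY]
  exact ⟨0, _, h1⟩

lemma integral_dual_map_eq_zero {B : Type*} [NormedAddCommGroup B] [NormedSpace ℝ B]
    [MeasurableSpace B] [BorelSpace B] (hG : IsGaussianSubspace G) {Y : Ω → B}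
    (hY : AEMeasurable Y P) (hm : ∀ ℓ : StrongDual ℝ B, AEMem G (fun w => ℓ (Y w)))
    (ℓ : StrongDual ℝ B) : (P.map Y)[ℓ] = 0 := by
  rw [integral_map hY (by fun_prop)]
  have h1 := ((hm ℓ).hasLaw hG)
  rw [h1.integral_eq, integral_id_gaussianReal]

/-- If the topology of `F` is induced by linear maps to separable Banach spaces, then the support
of a centered Gaussian `F`-valued variable is the closure of every subspace whose annihilator
consists of the functionals vanishing almost surely on the variable. -/
theorem setOf_forall_nhds_pos_eq_closure {F : Type*} [AddCommGroup F] [Module ℝ F]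
    [t : TopologicalSpace F] {ι : Type*} {B : ι → Type*} [∀ a, NormedAddCommGroup (B a)]
    [∀ a, NormedSpace ℝ (B a)] [∀ a, CompleteSpace (B a)] [∀ a, SecondCountableTopology (B a)]
    (Φ : ∀ a, F →ₗ[ℝ] B a) (ht : t = ⨅ a, TopologicalSpace.induced (Φ a) inferInstance)
    (hG : IsGaussianSubspace G) (X : Ω → F)
    (hmeas : ∀ a, AEStronglyMeasurable (fun w => Φ a (X w)) P)
    (hmem : ∀ a (ℓ : StrongDual ℝ (B a)), AEMem G (fun w => ℓ (Φ a (X w))))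
    (S : Submodule ℝ F)
    (hS : ∀ ℓ ∈ Submodule.span ℝ {ℓ : F →ₗ[ℝ] ℝ | ∃ (a : ι) (m : StrongDual ℝ (B a)),
      ∀ f, ℓ f = m (Φ a f)}, (∀ᵐ w ∂P, ℓ (X w) = 0) ↔ ∀ s ∈ S, ℓ s = 0) :
    {f | ∀ U ∈ 𝓝 f, 0 < P {w | X w ∈ U}} = closure (S : Set F) := by
  classical
  let _ : ∀ a, MeasurableSpace (B a) := fun a => borel _
  have _ : ∀ a, BorelSpace (B a) := fun a => ⟨rfl⟩
  let Ψ : ∀ s : Finset ι, F →ₗ[ℝ] (∀ a : s, B a) := fun s => LinearMap.pi fun a => Φ a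
  have hdecomp : ∀ (s : Finset ι) (ℓ : StrongDual ℝ (∀ a : s, B a)) (f : F),
      ℓ (Ψ s f) = ∑ a : s, (ℓ ∘L ContinuousLinearMap.single ℝ (fun a : s => B a) a) (Φ a f) := by
    intro s ℓ f
    conv_lhs => rw [← Finset.univ_sum_single (Ψ s f), map_sum]
    rfl
  have hY : ∀ s : Finset ι, AEMeasurable (fun w => Ψ s (X w)) P := fun s =>
    aemeasurable_pi_iff.2 fun a => (hmeas a).aemeasurable
  have hYm : ∀ (s : Finset ι) (ℓ : StrongDual ℝ (∀ a : s, B a)), AEMem G (fun w => ℓ (Ψ s (X w))) := by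
    intro s ℓ
    simp only [hdecomp]
    exact AEMem.sum _ fun a _ => hmem a _
  have hnhds : ∀ f : F, 𝓝 f = ⨅ a, comap (Φ a) (𝓝 (Φ a f)) := by
    intro f
    rw [ht, nhds_iInf]
    simp only [nhds_induced]
  have hbasis : ∀ (f : F) (U : Set F), U ∈ 𝓝 f ↔
      ∃ s : Finset ι, ∃ V : Set (∀ a : s, B a), IsOpen V ∧ Ψ s f ∈ V ∧ Ψ s ⁻¹' V ⊆ U := by
    intro f U
    rw [hnhds, Filter.mem_iInf_finite]
    refine exists_congr fun s => ?_
    have : ⨅ a ∈ s, comap (Φ a) (𝓝 (Φ a f)) = comap (Ψ s) (𝓝 (Ψ s f)) := by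
      rw [nhds_pi, Filter.pi, comap_iInf, iInf_subtype']
      simp only [comap_comap]
      rfl
    rw [this, ((nhds_basis_opens (Ψ s f)).comap (Ψ s)).mem_iff]
    constructor
    · rintro ⟨V, ⟨h1, h2⟩, h3⟩
      exact ⟨V, h2, h1, h3⟩
    · rintro ⟨V, h2, h1, h3⟩
      exact ⟨V, ⟨h1, h2⟩, h3⟩
  have hkey : ∀ s : Finset ι, (P.map fun w => Ψ s (X w)).support =
      closure ((S.map (Ψ s) : Submodule ℝ (∀ a : s, B a)) : Set (∀ a : s, B a)) := by
    intro s
    have hgl := (hasGaussianLaw_of_aemem hG (hY s) (hYm s)).isGaussian_map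
    refine support_eq_closure_of_annihilator
      (integral_dual_map_eq_zero hG (hY s) (hYm s)) _ fun ℓ => ?_
    rw [ae_map_iff (hY s) (isClosed_eq ℓ.continuous continuous_const).measurableSet]
    have hmem' : (ℓ : (∀ a : s, B a) →ₗ[ℝ] ℝ) ∘ₗ Ψ s ∈ Submodule.span ℝ {ℓ : F →ₗ[ℝ] ℝ |
        ∃ (a : ι) (m : StrongDual ℝ (B a)), ∀ f, ℓ f = m (Φ a f)} := by
      have : (ℓ : (∀ a : s, B a) →ₗ[ℝ] ℝ) ∘ₗ Ψ s = ∑ a : s,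
          ((ℓ ∘L ContinuousLinearMap.single ℝ (fun a : s => B a) a : StrongDual ℝ (B a)) :
            B a →ₗ[ℝ] ℝ) ∘ₗ Φ a := by
        ext f
        rw [LinearMap.sum_apply]
        exact hdecomp s ℓ f
      rw [this]
      exact Submodule.sum_mem _ fun a _ => Submodule.subset_span
        ⟨a, ℓ ∘L ContinuousLinearMap.single ℝ (fun a : s => B a) a, fun f => rfl⟩
    have := hS _ hmem'
    simpa using this
  ext f
  constructor
  · intro hf
    rw [mem_closure_iff_nhds]
    intro U hU
    obtain ⟨s, V, hVo, hfV, hVU⟩ := (hbasis f U).1 hU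
    have h1 : Ψ s f ∈ (P.map fun w => Ψ s (X w)).support := by
      rw [Measure.support_eq_forall_isOpen]
      intro W hW hWo
      rw [Measure.map_apply_of_aemeasurable (hY s) hWo.measurableSet]
      exact hf _ ((hbasis f _).2 ⟨s, W, hWo, hW, subset_rfl⟩)
    rw [hkey, mem_closure_iff] at h1
    obtain ⟨_, hx, x, hxS, rfl⟩ := h1 V hVo hfV
    exact ⟨x, hVU hx, hxS⟩
  · intro hf U hU
    obtain ⟨s, V, hVo, hfV, hVU⟩ := (hbasis f U).1 hU
    have h1 : Ψ s f ∈ (P.map fun w => Ψ s (X w)).support := by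
      rw [hkey, mem_closure_iff]
      intro W hWo hW
      obtain ⟨x, hx, hxS⟩ := mem_closure_iff_nhds.1 hf _
        ((hbasis f _).2 ⟨s, W, hWo, hW, subset_rfl⟩)
      exact ⟨Ψ s x, hx, x, hxS, rfl⟩
    rw [Measure.support_eq_forall_isOpen] at h1
    have h2 := h1 V hfV hVo
    rw [Measure.map_apply_of_aemeasurable (hY s) hVo.measurableSet] at h2
    exact h2.trans_le (measure_mono fun w hw => hVU hw)

end Field

end Support

section ContinuousMaps

variable {K : Type*} [MetricSpace K] [CompactSpace K]
  {W : Type*} [NormedAddCommGroup W] [NormedSpace ℝ W] [FiniteDimensional ℝ W]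

lemma exists_partition_dist_lt {ε : ℝ} (hε : 0 < ε) :
    ∃ (t : Finset K) (g : K → C(K, ℝ)), (∀ i x, 0 ≤ g i x) ∧ (∀ x, ∑ i ∈ t, g i x = 1) ∧
      ∀ i x, g i x ≠ 0 → dist i x < ε := by
  obtain ⟨t, htf, ht⟩ := Metric.totallyBounded_iff.1
    (isCompact_univ (X := K)).totallyBounded ε hε
  lift t to Finset K using htf
  let φ : K → C(K, ℝ) := fun i => ⟨fun x => max 0 (ε - dist i x), by fun_prop⟩
  have hφ0 : ∀ i x, 0 ≤ φ i x := fun i x => le_max_left _ _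
  have hpos : ∀ x, 0 < ∑ i ∈ t, φ i x := by
    intro x
    obtain ⟨i, hi, hx⟩ := Set.mem_iUnion₂.1 (ht (Set.mem_univ x))
    refine Finset.sum_pos' (fun i _ => hφ0 i x) ⟨i, hi, ?_⟩
    rw [Metric.mem_ball, dist_comm] at hx
    exact lt_max_of_lt_right (sub_pos.2 hx)
  refine ⟨t, fun i => ⟨fun x => φ i x / ∑ j ∈ t, φ j x,
    (φ i).continuous.div (by fun_prop) fun x => (hpos x).ne'⟩, fun i x => ?_, fun x => ?_,
    fun i x hx => ?_⟩
  · exact div_nonneg (hφ0 i x) (hpos x).le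
  · simp only [ContinuousMap.coe_mk, ← Finset.sum_div]
    exact div_self (hpos x).ne'
  · by_contra hlt
    refine hx ?_
    have : φ i x = 0 := max_eq_left (by linarith)
    simp [this]

/-- The map `w ↦ g w` from `W` to `C(K, W)`, for a continuous real function `g`. -/
def smulConst (g : C(K, ℝ)) : W →L[ℝ] C(K, W) :=
  LinearMap.toContinuousLinearMap
    { toFun := fun w => ⟨fun x => g x • w, by fun_prop⟩
      map_add' := fun v w => by ext x; exact smul_add _ _ _
      map_smul' := fun c w => by ext x; exact smul_comm _ _ _ }

variable (K W) in
/-- The identity of `C(K, W)` is a pointwise limit of maps depending on finitely many values. -/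
lemma exists_tendsto_sum_smulConst :
    ∃ (t : ℕ → Finset K) (g : ℕ → K → C(K, ℝ)), ∀ f : C(K, W),
      Tendsto (fun n => ∑ i ∈ t n, smulConst (g n i) (f i)) atTop (𝓝 f) := by
  choose t g h0 h1 h2 using fun n : ℕ =>
    exists_partition_dist_lt (K := K) (Nat.one_div_pos_of_nat (α := ℝ) (n := n))
  refine ⟨t, g, fun f => ?_⟩
  rw [Metric.tendsto_atTop]
  intro δ hδ
  obtain ⟨ε, hε, hf⟩ := Metric.uniformContinuous_iff.1
    (CompactSpace.uniformContinuous_of_continuous f.continuous) (δ / 2) (half_pos hδ)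
  obtain ⟨N, hN⟩ := exists_nat_one_div_lt hε
  refine ⟨N, fun n hn => ?_⟩
  refine lt_of_le_of_lt ?_ (half_lt_self hδ)
  rw [ContinuousMap.dist_le (half_pos hδ).le]
  intro x
  rw [dist_eq_norm]
  have e : (∑ i ∈ t n, smulConst (g n i) (f i)) x - f x = ∑ i ∈ t n, g n i x • (f i - f x) := by
    simp only [smul_sub, Finset.sum_sub_distrib, ← Finset.sum_smul, h1, one_smul]
    rw [ContinuousMap.sum_apply]
    rfl
  rw [e]
  calc ‖∑ i ∈ t n, g n i x • (f i - f x)‖ ≤ ∑ i ∈ t n, g n i x * (δ / 2) := by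
        refine norm_sum_le_of_le _ fun i _ => ?_
        rw [norm_smul, Real.norm_of_nonneg (h0 n i x)]
        by_cases hx : g n i x = 0
        · simp [hx]
        · refine mul_le_mul_of_nonneg_left ?_ (h0 n i x)
          rw [← dist_eq_norm]
          refine (hf ((h2 n i x hx).trans (lt_of_le_of_lt ?_ hN))).le
          exact Nat.one_div_le_one_div hn
    _ = δ / 2 := by rw [← Finset.sum_mul, h1, one_mul]

variable {Ω : Type*} [MeasurableSpace Ω] {P : Measure Ω}
  {G : Submodule ℝ (Lp ℝ 2 P)}

lemma aestronglyMeasurable_of_forall_dual {Z : Ω → W}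
    (h : ∀ ℓ : StrongDual ℝ W, AEMem G (fun w => ℓ (Z w))) : AEStronglyMeasurable Z P := by
  let b := Module.finBasis ℝ W
  have e : Z = fun w => ∑ i, (LinearMap.toContinuousLinearMap (b.coord i)) (Z w) • b i := by
    funext w
    exact (b.sum_repr (Z w)).symm
  rw [e]
  exact Finset.aestronglyMeasurable_fun_sum _ fun i _ =>
    (h _).aestronglyMeasurable.smul_const _

lemma aestronglyMeasurable_continuousMap {Y : Ω → C(K, W)}
    (h : ∀ (x : K) (ℓ : StrongDual ℝ W), AEMem G (fun w => ℓ (Y w x))) :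
    AEStronglyMeasurable Y P := by
  obtain ⟨t, g, htg⟩ := exists_tendsto_sum_smulConst K W
  refine aestronglyMeasurable_of_tendsto_ae atTop (fun n => ?_)
    (.of_forall fun w => htg (Y w))
  exact Finset.aestronglyMeasurable_fun_sum _ fun i _ =>
    (smulConst (g n i)).continuous.comp_aestronglyMeasurable
      (aestronglyMeasurable_of_forall_dual (h i))

lemma aemem_dual_continuousMap [IsProbabilityMeasure P] (hG : IsGaussianSubspace G)
    (hc : IsClosed (G : Set (Lp ℝ 2 P))) {Y : Ω → C(K, W)}
    (h : ∀ (x : K) (ℓ : StrongDual ℝ W), AEMem G (fun w => ℓ (Y w x)))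
    (ℓ : StrongDual ℝ C(K, W)) : AEMem G (fun w => ℓ (Y w)) := by
  obtain ⟨t, g, htg⟩ := exists_tendsto_sum_smulConst K W
  refine AEMem.of_tendsto hG hc (Z := fun n w => ℓ (∑ i ∈ t n, smulConst (g n i) (Y w i)))
    (fun n => ?_) (.of_forall fun w => (ℓ.continuous.tendsto _).comp (htg (Y w)))
  simp only [map_sum]
  exact AEMem.sum _ fun i _ => h i (ℓ ∘L smulConst (g n i))

end ContinuousMaps

section Calculus

variable {E : Type*} [NormedAddCommGroup E] [NormedSpace ℝ E]
  {W : Type*} [NormedAddCommGroup W] [NormedSpace ℝ W]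
  {Ω : Type*} [MeasurableSpace Ω] {P : Measure Ω}

lemma hasFDerivWithinAt_integral_of_dominated {F : E → Ω → W} {F' : Ω → E →L[ℝ] W} {s u : Set E}
    {x : E} {bound : Ω → ℝ} (hx : x ∈ s) (hu : u ∈ 𝓝[s] x) (hF : ∀ y ∈ s, Integrable (F y) P)
    (hF' : Integrable F' P) (hb : Integrable bound P)
    (hlip : ∀ᵐ w ∂P, ∀ y ∈ u, ‖F y w - F x w‖ ≤ bound w * ‖y - x‖)
    (hd : ∀ᵐ w ∂P, HasFDerivWithinAt (fun y => F y w) (F' w) s x) :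
    HasFDerivWithinAt (fun y => ∫ w, F y w ∂P) (∫ w, F' w ∂P) s x := by
  rw [hasFDerivWithinAt_iff_tendsto]
  have h1 : Tendsto (fun y => ∫ w, ‖y - x‖⁻¹ * ‖F y w - F x w - F' w (y - x)‖ ∂P) (𝓝[s] x)
      (𝓝 (∫ _, (0 : ℝ) ∂P)) := by
    refine tendsto_integral_filter_of_dominated_convergence (fun w => |bound w| + ‖F' w‖) ?_ ?_
      (hb.abs.add hF'.norm) ?_
    · filter_upwards [self_mem_nhdsWithin] with y hy
      exact ((((hF y hy).sub (hF x hx)).sub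
        (hF'.apply_continuousLinearMap (y - x))).norm.const_mul _).aestronglyMeasurable
    · filter_upwards [hu] with y hy
      filter_upwards [hlip] with w hw
      rw [Real.norm_of_nonneg (by positivity)]
      rcases eq_or_ne y x with rfl | hne
      · simp only [sub_self, norm_zero, inv_zero, zero_mul]
        positivity
      · have hpos : 0 < ‖y - x‖ := norm_pos_iff.2 (sub_ne_zero.2 hne)
        rw [inv_mul_le_iff₀ hpos]
        calc ‖F y w - F x w - F' w (y - x)‖ ≤ ‖F y w - F x w‖ + ‖F' w (y - x)‖ := norm_sub_le _ _
          _ ≤ |bound w| * ‖y - x‖ + ‖F' w‖ * ‖y - x‖ :=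
            add_le_add ((hw y hy).trans (mul_le_mul_of_nonneg_right (le_abs_self _) hpos.le))
              ((F' w).le_opNorm _)
          _ = _ := by ring
    · filter_upwards [hd] with w hw
      exact hasFDerivWithinAt_iff_tendsto.1 hw
  rw [integral_zero] at h1
  refine squeeze_zero' (.of_forall fun y => by positivity) ?_ h1
  filter_upwards [self_mem_nhdsWithin] with y hy
  rw [integral_const_mul]
  refine mul_le_mul_of_nonneg_left ?_ (by positivity)
  rw [ContinuousLinearMap.integral_apply hF', ← integral_sub (hF y hy) (hF x hx),
    ← integral_sub (f := fun w => F y w - F x w) ((hF y hy).sub (hF x hx)) (hF'.apply_continuousLinearMap _)]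
  exact norm_integral_le_integral_norm _

lemma hasFDerivWithinAt_integral_comp_of_dominated {D : Type*} [NormedAddCommGroup D]
    [NormedSpace ℝ D] [CompleteSpace D] [CompleteSpace W] {F : E → Ω → W} {F' : Ω → D} {γ : Ω → ℝ}
    {L : D →L[ℝ] (E →L[ℝ] W)} {s u : Set E}
    {x : E} {bound : Ω → ℝ} (hx : x ∈ s) (hu : u ∈ 𝓝[s] x) (hF : ∀ y ∈ s, Integrable (F y) P)
    (hF' : Integrable (fun w => γ w • F' w) P) (hb : Integrable bound P)
    (hlip : ∀ᵐ w ∂P, ∀ y ∈ u, ‖F y w - F x w‖ ≤ bound w * ‖y - x‖)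
    (hd : ∀ᵐ w ∂P, HasFDerivWithinAt (fun y => F y w) (γ w • L (F' w)) s x) :
    HasFDerivWithinAt (fun y => ∫ w, F y w ∂P) (L (∫ w, γ w • F' w ∂P)) s x := by
  rw [← L.integral_comp_comm hF']
  refine hasFDerivWithinAt_integral_of_dominated hx hu hF (L.integrable_comp hF') hb hlip ?_
  simpa only [map_smul] using hd

variable {G : Submodule ℝ (Lp ℝ 2 P)} {V : Type*} [NormedAddCommGroup V] [NormedSpace ℝ V]

lemma aemem_dual_of_forall_apply [FiniteDimensional ℝ E] {T : Ω → E →L[ℝ] W}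
    (h : ∀ (v : E) (ℓ : StrongDual ℝ W), AEMem G (fun w => ℓ (T w v)))
    (L : StrongDual ℝ (E →L[ℝ] W)) : AEMem G (fun w => L (T w)) := by
  let b := Module.finBasis ℝ E
  let c : Fin (Module.finrank ℝ E) → StrongDual ℝ E :=
    fun j => LinearMap.toContinuousLinearMap (b.coord j)
  have e : ∀ S : E →L[ℝ] W, S = ∑ j, (c j).smulRight (S (b j)) := by
    intro S
    ext v
    conv_lhs => rw [← b.sum_repr v, map_sum]
    rw [_root_.sum_apply]
    refine Finset.sum_congr rfl fun j _ => ?_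
    rw [map_smul]
    rfl
  have e' : (fun w => L (T w)) = fun w => ∑ j,
      (L ∘L ContinuousLinearMap.smulRightL ℝ E W (c j)) (T w (b j)) := by
    funext w
    conv_lhs => rw [e (T w), map_sum]
    rfl
  rw [e']
  exact AEMem.sum _ fun j _ => h (b j) _

lemma aemem_dual_iteratedFDerivWithin [FiniteDimensional ℝ E] [IsProbabilityMeasure P]
    (hG : IsGaussianSubspace G) (hc : IsClosed (G : Set (Lp ℝ 2 P))) {s : Set E}
    (hs : UniqueDiffOn ℝ s) (hs' : s ⊆ closure (interior s)) {r : ℕ∞} {φ : Ω → E → V}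
    (hφ : ∀ w, ContDiffOn ℝ r (φ w) s)
    (h0 : ∀ x ∈ s, ∀ ℓ : StrongDual ℝ V, AEMem G (fun w => ℓ (φ w x)))
    (i : ℕ) (hi : (i : ℕ∞) ≤ r) (x : E) (hx : x ∈ s)
    (ℓ : StrongDual ℝ (E [×i]→L[ℝ] V)) :
    AEMem G (fun w => ℓ (iteratedFDerivWithin ℝ i (φ w) s x)) := by
  have hcont : ∀ (i : ℕ), (i : ℕ∞) ≤ r → ∀ w, ContinuousOn (iteratedFDerivWithin ℝ i (φ w) s) s :=
    fun i hi w => (hφ w).continuousOn_iteratedFDerivWithin (mod_cast hi) hs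
  induction i generalizing x with
  | zero =>
    exact h0 x hx (ℓ ∘L ((continuousMultilinearCurryFin0 ℝ E V).symm : V →L[ℝ] E [×0]→L[ℝ] V))
  | succ i ih =>
    have hi' : (i : ℕ∞) < r := lt_of_lt_of_le (by exact_mod_cast Nat.lt_succ_self i) hi
    have hint : ∀ y ∈ interior s,
        AEMem G (fun w => ℓ (iteratedFDerivWithin ℝ (i + 1) (φ w) s y)) := by
      intro y hy
      refine aemem_dual_of_forall_apply (T := fun w =>
        fderivWithin ℝ (iteratedFDerivWithin ℝ i (φ w) s) s y) (fun v m => ?_)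
        (ℓ ∘L ((continuousMultilinearCurryLeftEquiv ℝ (fun _ : Fin (i + 1) => E) V).symm :
          (E →L[ℝ] E [×i]→L[ℝ] V) →L[ℝ] E [×(i + 1)]→L[ℝ] V))
      have hd : ∀ w, HasFDerivAt (iteratedFDerivWithin ℝ i (φ w) s)
          (fderivWithin ℝ (iteratedFDerivWithin ℝ i (φ w) s) s y) y := fun w =>
        (((hφ w).differentiableOn_iteratedFDerivWithin (mod_cast hi') hs y
          (interior_subset hy)).hasFDerivWithinAt).hasFDerivAt (mem_interior_iff_mem_nhds.1 hy)
      have hs1 : ∀ᶠ t in 𝓝 (0 : ℝ), y + t • v ∈ s := by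
        have : Tendsto (fun t : ℝ => y + t • v) (𝓝 0) (𝓝 (y + (0 : ℝ) • v)) :=
          Continuous.tendsto (by fun_prop) 0
        rw [zero_smul, add_zero] at this
        exact this (mem_interior_iff_mem_nhds.1 hy)
      obtain ⟨δ, hδ, hδs⟩ := Metric.eventually_nhds_iff.1 hs1
      let c : ℕ → ℝ := fun n => (n + 2) / δ
      have hcs : ∀ n, y + (c n)⁻¹ • v ∈ s := by
        intro n
        refine hδs ?_
        rw [dist_zero_right, inv_div, Real.norm_of_nonneg (by positivity),
          div_lt_iff₀ (by positivity)]
        nlinarith [hδ, Nat.cast_nonneg (α := ℝ) n]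
      have hct : Tendsto (fun n => ‖c n‖) atTop atTop := by
        refine tendsto_norm_atTop_atTop.comp ?_
        exact (tendsto_atTop_add_const_right _ _ tendsto_natCast_atTop_atTop).atTop_div_const hδ
      refine AEMem.of_tendsto hG hc (Z := fun n w => m (c n •
        (iteratedFDerivWithin ℝ i (φ w) s (y + (c n)⁻¹ • v) - iteratedFDerivWithin ℝ i (φ w) s y)))
        (fun n => ?_) (.of_forall fun w => (m.continuous.tendsto _).comp ((hd w).lim v hct))
      simp only [map_smul, map_sub, smul_eq_mul]
      exact ((ih hi'.le _ (hcs n) m).sub (ih hi'.le y (interior_subset hy) m)).const_mul _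
    obtain ⟨u, hu, hux⟩ := mem_closure_iff_seq_limit.1 (hs' hx)
    refine AEMem.of_tendsto hG hc (fun n => hint (u n) (hu n)) (.of_forall fun w => ?_)
    refine (ℓ.continuous.tendsto _).comp ((hcont (i + 1) hi w x hx).tendsto.comp ?_)
    exact tendsto_nhdsWithin_iff.2 ⟨hux, .of_forall fun n => interior_subset (hu n)⟩

lemma hasFTaylorSeriesUpToOn_integral [CompleteSpace V] {s : Set E}
    (hs : UniqueDiffOn ℝ s) (hs' : ∀ x ∈ s, ∃ K ⊆ s, IsCompact K ∧ Convex ℝ K ∧ K ∈ 𝓝[s] x)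
    {r : ℕ∞} {φ : Ω → E → V}
    (hφ : ∀ w, ContDiffOn ℝ r (φ w) s) {γ : Ω → ℝ}
    (hint : ∀ i : ℕ, (i : ℕ∞) ≤ r → ∀ x ∈ s,
      Integrable (fun w => γ w • iteratedFDerivWithin ℝ i (φ w) s x) P)
    (hbound : ∀ i : ℕ, (i : ℕ∞) ≤ r → ∀ K ⊆ s, IsCompact K → ∃ b : Ω → ℝ, Integrable b P ∧
      ∀ᵐ w ∂P, ∀ x ∈ K, ‖γ w • iteratedFDerivWithin ℝ i (φ w) s x‖ ≤ b w) :
    HasFTaylorSeriesUpToOn r (fun x => ∫ w, γ w • φ w x ∂P)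
      (fun x i => ∫ w, γ w • iteratedFDerivWithin ℝ i (φ w) s x ∂P) s := by
  refine ⟨fun x hx => ?_, fun m hm x hx => ?_, fun m hm x hx => ?_⟩
  · exact (((continuousMultilinearCurryFin0 ℝ E V : (E [×0]→L[ℝ] V) →L[ℝ] V).integral_comp_comm
      (hint 0 bot_le x hx)).symm)
  · obtain ⟨K, hKs, hK, hKc, hKx⟩ := hs' x hx
    have hm' : (m : ℕ∞) < r := by exact_mod_cast hm
    have hm1 : ((m + 1 : ℕ) : ℕ∞) ≤ r := Order.add_one_le_of_lt hm'
    obtain ⟨b, hb, hbK⟩ := hbound (m + 1) hm1 K hKs hK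
    have hd : ∀ w, ∀ y ∈ s, HasFDerivWithinAt (fun y => γ w • iteratedFDerivWithin ℝ m (φ w) s y)
        (γ w • fderivWithin ℝ (iteratedFDerivWithin ℝ m (φ w) s) s y) s y := fun w y hy =>
      (((hφ w).differentiableOn_iteratedFDerivWithin hm hs y
          hy).hasFDerivWithinAt).const_smul (γ w)
    refine hasFDerivWithinAt_integral_comp_of_dominated (P := P)
      (L := (continuousMultilinearCurryLeftEquiv ℝ
        (fun _ : Fin (m + 1) => E) V).toContinuousLinearEquiv.toContinuousLinearMap) hx hKx
      (hint m hm'.le) (hint (m + 1) hm1 x hx) hb ?_ (.of_forall fun w => ?_)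
    · filter_upwards [hbK] with w hw y hy
      refine hKc.norm_image_sub_le_of_norm_hasFDerivWithin_le
        (fun z hz => (hd w z (hKs hz)).mono hKs) (fun z hz => ?_) (mem_of_mem_nhdsWithin hx hKx) hy
      refine le_trans (le_of_eq ?_) (hw z hz)
      rw [norm_smul, norm_smul, norm_fderivWithin_iteratedFDerivWithin]
    · exact hd w x hx
  · obtain ⟨K, hKs, hK, hKc, hKx⟩ := hs' x hx
    have hm' : (m : ℕ∞) ≤ r := by exact_mod_cast hm
    obtain ⟨b, hb, hbK⟩ := hbound m hm' K hKs hK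
    refine continuousWithinAt_of_dominated (bound := b) ?_ ?_ hb ?_
    · filter_upwards [self_mem_nhdsWithin] with y hy
      exact (hint m hm' y hy).aestronglyMeasurable
    · filter_upwards [hKx] with y hy
      filter_upwards [hbK] with w hw
      exact hw y hy
    · exact .of_forall fun w =>
        (((hφ w).continuousOn_iteratedFDerivWithin hm hs) x hx).const_smul (γ w)

end Calculus

section Charts

variable {E : Type*} [NormedAddCommGroup E] [NormedSpace ℝ E]
  {H : Type*} [TopologicalSpace H] (I : ModelWithCorners ℝ E H)
  {M : Type*} [TopologicalSpace M]

lemma uniqueDiffOn_extend_target (e : OpenPartialHomeomorph M H) :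
    UniqueDiffOn ℝ (e.extend I).target := by
  rw [e.extend_target, Set.inter_comm]
  exact I.uniqueDiffOn.inter (I.continuous_symm.isOpen_preimage _ e.open_target)

lemma extend_target_subset_closure_interior (e : OpenPartialHomeomorph M H) :
    (e.extend I).target ⊆ closure (interior (e.extend I).target) := by
  have ho : IsOpen (I.symm ⁻¹' e.target) := I.continuous_symm.isOpen_preimage _ e.open_target
  rw [e.extend_target, interior_inter, ho.interior_eq]
  exact fun x hx => ho.inter_closure ⟨hx.1, I.range_subset_closure_interior hx.2⟩

lemma exists_compact_convex_nhdsWithin_extend_target [FiniteDimensional ℝ E]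
    (e : OpenPartialHomeomorph M H) {x : E} (hx : x ∈ (e.extend I).target) :
    ∃ K ⊆ (e.extend I).target, IsCompact K ∧ Convex ℝ K ∧ K ∈ 𝓝[(e.extend I).target] x := by
  have ho : IsOpen (I.symm ⁻¹' e.target) := I.continuous_symm.isOpen_preimage _ e.open_target
  have : ProperSpace E := FiniteDimensional.proper ℝ E
  rw [e.extend_target] at hx ⊢
  obtain ⟨ε, hε, hb⟩ := Metric.nhds_basis_closedBall.mem_iff.1 (ho.mem_nhds hx.1)
  refine ⟨Metric.closedBall x ε ∩ Set.range I, Set.inter_subset_inter_left _ hb,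
    (isCompact_closedBall x ε).inter_right I.isClosed_range,
    (convex_closedBall x ε).inter I.convex_range, ?_⟩
  refine inter_mem (mem_nhdsWithin_of_mem_nhds (Metric.closedBall_mem_nhds x hε)) ?_
  exact mem_of_superset self_mem_nhdsWithin Set.inter_subset_right

variable [ChartedSpace H M] {V : Type*} [NormedAddCommGroup V] [NormedSpace ℝ V] {I}

lemma contMDiffOn_source_iff {r : ℕ∞} {e : OpenPartialHomeomorph M H}
    (he : e ∈ IsManifold.maximalAtlas I ∞ M) (f : M → V) :
    ContMDiffOn I 𝓘(ℝ, V) r f e.source ↔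
      ContDiffOn ℝ r (f ∘ (e.extend I).symm) (e.extend I).target := by
  have he' : e ∈ IsManifold.maximalAtlas I r M :=
    IsManifold.maximalAtlas_subset_of_le (by exact_mod_cast le_top) he
  rw [contMDiffOn_iff_of_mem_maximalAtlas' he'
    (IsManifold.chart_mem_maximalAtlas (I := 𝓘(ℝ, V)) (0 : V)) subset_rfl
    (fun x _ => Set.mem_univ _), ← e.extend_target_eq_image_source]
  rfl

lemma contDiffOn_comp_extend_symm {r : ℕ∞} {e : OpenPartialHomeomorph M H}
    (he : e ∈ IsManifold.maximalAtlas I ∞ M) {f : M → V} (hf : ContMDiff I 𝓘(ℝ, V) r f) :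
    ContDiffOn ℝ r (f ∘ (e.extend I).symm) (e.extend I).target :=
  (contMDiffOn_source_iff he f).1 hf.contMDiffOn

lemma contMDiff_of_forall_maximalAtlas [IsManifold I ∞ M] {r : ℕ∞} {f : M → V}
    (h : ∀ e ∈ IsManifold.maximalAtlas I ∞ M,
      ContDiffOn ℝ r (f ∘ (e.extend I).symm) (e.extend I).target) :
    ContMDiff I 𝓘(ℝ, V) r f :=
  contMDiff_of_locally_contMDiffOn fun x => ⟨(chartAt H x).source, (chartAt H x).open_source,
    mem_chart_source H x,
    (contMDiffOn_source_iff (IsManifold.chart_mem_maximalAtlas x) f).2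
      (h _ (IsManifold.chart_mem_maximalAtlas x))⟩

end Charts

section Jets

variable {E : Type*} [NormedAddCommGroup E] [NormedSpace ℝ E]
  {H : Type*} [TopologicalSpace H] (I : ModelWithCorners ℝ E H)
  (M : Type*) [TopologicalSpace M] [ChartedSpace H M]

/-- A chart, an order of differentiation at most `r` and a compact subset of the target of the
chart. -/
structure ChartJet (r : ℕ∞) where
  chart : OpenPartialHomeomorph M H
  chart_mem : chart ∈ IsManifold.maximalAtlas I ∞ M
  order : ℕ
  order_le : (order : ℕ∞) ≤ r
  carrier : Set E
  isCompact : IsCompact carrier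
  subset_target : carrier ⊆ (chart.extend I).target

variable {I M} {V : Type*} [NormedAddCommGroup V] [NormedSpace ℝ V] {r : ℕ∞}

instance (a : ChartJet I M r) : CompactSpace a.carrier := isCompact_iff_compactSpace.1 a.isCompact

/-- The continuous functions from `K` to `W`, for the norm topology of `W`. -/
abbrev NormContinuousMap (K W : Type*) [TopologicalSpace K] [NormedAddCommGroup W] := C(K, W)

/-- The derivative of a function in a chart, restricted to a compact subset of its target. -/
def ChartJet.deriv (a : ChartJet I M r) :
    C^r⟮I, M; 𝓘(ℝ, V), V⟯ →ₗ[ℝ] NormContinuousMap a.carrier (E [×a.order]→L[ℝ] V) where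
  toFun f := ⟨fun x => chartDeriv I a.chart a.order f x, by
    have h := (contDiffOn_comp_extend_symm a.chart_mem f.contMDiff).continuousOn_iteratedFDerivWithin
      (m := a.order) (mod_cast a.order_le) (uniqueDiffOn_extend_target I a.chart)
    exact (h.mono a.subset_target).domRestrict⟩
  map_add' f g := by
    ext1 x
    have hx := a.subset_target x.2
    exact iteratedFDerivWithin_add_apply
      (((contDiffOn_comp_extend_symm a.chart_mem f.contMDiff) x hx).of_le (mod_cast a.order_le))
      (((contDiffOn_comp_extend_symm a.chart_mem g.contMDiff) x hx).of_le (mod_cast a.order_le))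
      (uniqueDiffOn_extend_target I a.chart) hx
  map_smul' c f := by
    ext1 x
    have hx := a.subset_target x.2
    exact iteratedFDerivWithin_const_smul_apply
      (((contDiffOn_comp_extend_symm a.chart_mem f.contMDiff) x hx).of_le (mod_cast a.order_le))
      (uniqueDiffOn_extend_target I a.chart) hx

lemma ChartJet.deriv_apply (a : ChartJet I M r) (f : C^r⟮I, M; 𝓘(ℝ, V), V⟯) (x : a.carrier) :
    a.deriv f x = iteratedFDerivWithin ℝ a.order (f ∘ (a.chart.extend I).symm)
      (a.chart.extend I).target x := rfl

lemma weakWhitneyTopology_eq_iInf :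
    weakWhitneyTopology I (M := M) (V := V) r =
      ⨅ a : ChartJet I M r, TopologicalSpace.induced a.deriv inferInstance := by
  have h1 : ∀ a : ChartJet I M r,
      TopologicalSpace.induced (a.deriv (V := V)) inferInstance =
      TopologicalSpace.induced (fun f : C^r⟮I, M; 𝓘(ℝ, V), V⟯ => UniformFun.ofFun
        (a.carrier.domRestrict (chartDeriv I a.chart a.order f))) inferInstance := by
    intro a
    exact (congrArg (TopologicalSpace.induced a.deriv)
      ContinuousMap.isUniformEmbedding_uniformFunOfFun.isEmbedding.eq_induced).trans induced_compose
  simp only [h1]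
  unfold weakWhitneyTopology
  simp only [UniformOnFun.topologicalSpace_eq, induced_iInf, induced_compose]
  refine le_antisymm (le_iInf fun a => ?_) ?_
  · exact iInf_le_of_le a.chart <| iInf_le_of_le a.chart_mem <| iInf_le_of_le a.order <|
      iInf_le_of_le a.order_le <| iInf_le_of_le a.carrier <|
      iInf_le_of_le ⟨a.isCompact, a.subset_target⟩ le_rfl
  · refine le_iInf fun e => le_iInf fun he => le_iInf fun i => le_iInf fun hi => le_iInf fun K =>
      le_iInf fun hK => ?_
    exact iInf_le_of_le ⟨e, he, i, hi, K, hK.1, hK.2⟩ le_rfl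

end Jets

section FiniteDimensionalMultilinear

variable {E : Type*} [NormedAddCommGroup E] [NormedSpace ℝ E] [FiniteDimensional ℝ E]
  {V : Type*} [NormedAddCommGroup V] [NormedSpace ℝ V] [FiniteDimensional ℝ V]

instance (n : ℕ) : FiniteDimensional ℝ (E [×n]→L[ℝ] V) :=
  Module.Finite.of_injective
    (ContinuousMultilinearMap.toMultilinearMapLinear :
      (E [×n]→L[ℝ] V) →ₗ[ℝ] MultilinearMap ℝ (fun _ : Fin n => E) V)
    ContinuousMultilinearMap.toMultilinearMap_injective

lemma secondCountableTopology_continuousMap_multilinear (K : Set E) [CompactSpace K] (n : ℕ) :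
    SecondCountableTopology (NormContinuousMap K (E [×n]→L[ℝ] V)) := by
  have : ProperSpace E := FiniteDimensional.proper ℝ E
  have : ProperSpace (E [×n]→L[ℝ] V) := FiniteDimensional.proper ℝ _
  infer_instance

end FiniteDimensionalMultilinear

section Series

variable {Ω : Type*} [MeasurableSpace Ω] {P : Measure Ω} [IsProbabilityMeasure P]

lemma eq_zero_of_tendsto_sum_mul_gaussian {ξ : ℕ → Ω → ℝ}
    (hξ : ∀ n, HasLaw (ξ n) (gaussianReal 0 1) P) (hi : iIndepFun ξ P) {a : ℕ → ℝ}
    (h : ∀ᵐ w ∂P, Tendsto (fun N => ∑ n ∈ Finset.range N, a n * ξ n w) atTop (𝓝 0)) (m : ℕ) :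
    a m = 0 := by
  have hm : ∀ n, AEMeasurable (fun w => a n * ξ n w) P := fun n =>
    (hξ n).aemeasurable.const_mul (a n)
  have hi' : iIndepFun (fun n w => a n * ξ n w) P :=
    hi.comp (fun n x => a n * x) fun n => by fun_prop
  have h1 := tendsto_integral_cexp (P := P) (Y := fun _ => 0)
    (Z := fun N w => ∑ n ∈ Finset.range N, a n * ξ n w) (fun N =>
      (Finset.aemeasurable_fun_sum _ fun n _ => hm n).aestronglyMeasurable) h
  have h2 : ∀ N, ∫ w, Complex.exp ((∑ n ∈ Finset.range N, a n * ξ n w : ℝ) * Complex.I) ∂P =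
      ∏ n ∈ Finset.range N, Complex.exp (-(a n : ℂ) ^ 2 / 2) := by
    intro N
    have h3 := congrFun ((hi'.restrict (Finset.range N)).charFun_map_fun_finsetSum_eq_prod
      fun n _ => hm n) 1
    rw [charFun_apply_real, integral_map
      (Finset.aemeasurable_fun_sum _ fun n _ => hm n) (by fun_prop)] at h3
    simp only [Complex.ofReal_one, one_mul] at h3
    rw [h3, Finset.prod_apply]
    refine Finset.prod_congr rfl fun n _ => ?_
    have h4 : P.map (fun w => a n * ξ n w) = (gaussianReal 0 1).map (a n * ·) := by
      rw [← (hξ n).map_eq, AEMeasurable.map_map_of_aemeasurable (by fun_prop) (hξ n).aemeasurable]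
      rfl
    rw [h4, gaussianReal_map_const_mul, charFun_gaussianReal]
    simp
    ring_nf
  have h5 : ∀ᶠ N in atTop, ‖∫ w, Complex.exp ((∑ n ∈ Finset.range N, a n * ξ n w : ℝ) *
      Complex.I) ∂P‖ ≤ Real.exp (-(a m) ^ 2 / 2) := by
    filter_upwards [eventually_gt_atTop m] with N hN
    rw [h2, norm_prod]
    have h6 : ∀ n, ‖Complex.exp (-(a n : ℂ) ^ 2 / 2)‖ = Real.exp (-(a n) ^ 2 / 2) := by
      intro n
      rw [Complex.norm_exp]
      norm_cast
    simp only [h6]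
    rw [← Finset.mul_prod_erase _ _ (Finset.mem_range.2 hN)]
    refine mul_le_of_le_one_right (Real.exp_pos _).le (Finset.prod_le_one
      (fun n _ => (Real.exp_pos _).le) fun n _ => ?_)
    rw [Real.exp_le_one_iff]
    nlinarith [sq_nonneg (a n)]
  have h7 := le_of_tendsto h1.norm h5
  simp only [Complex.ofReal_zero, zero_mul, Complex.exp_zero, integral_const, probReal_univ,
    one_smul, norm_one, Real.one_le_exp_iff] at h7
  have : a m ^ 2 = 0 := le_antisymm (by linarith) (sq_nonneg _)
  simpa using this

end Series

section RandomField

variable {E : Type*} [NormedAddCommGroup E] [NormedSpace ℝ E]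
  {H : Type*} [TopologicalSpace H] {I : ModelWithCorners ℝ E H}
  {M : Type*} [TopologicalSpace M] [ChartedSpace H M]
  {Ω : Type*} [MeasurableSpace Ω] {P : Measure Ω} {k : ℕ} {r : ℕ∞}
  {X : M → Ω → EuclideanSpace ℝ (Fin k)}

omit [TopologicalSpace M] in
lemma gaussianSpace_isClosed :
    IsClosed (gaussianSpace X P : Set (Lp ℝ 2 P)) :=
  Submodule.isClosed_topologicalClosure _

lemma IsGaussianRandomField.isGaussianSubspace [IsProbabilityMeasure P]
    (hX : IsGaussianRandomField I r X P) : IsGaussianSubspace (gaussianSpace X P) := by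
  have hZ : IsGaussianProcess (fun (t : M × Fin k) w => X t.1 w t.2) P := by
    have := (hX.gaussian.comp_right (Prod.fst : M × Fin k → M)).comp_left
      (fun t => (EuclideanSpace.proj t.2 : EuclideanSpace ℝ (Fin k) →L[ℝ] ℝ))
    exact this
  have h0 : ∀ t : M × Fin k, ∫ w, X t.1 w t.2 ∂P = 0 := by
    intro t
    have h1 := (EuclideanSpace.proj t.2 : EuclideanSpace ℝ (Fin k) →L[ℝ] ℝ).integral_comp_comm
      (hX.gaussian.hasGaussianLaw_eval t.1).integrable
    rw [hX.centered, map_zero] at h1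
    exact h1
  have := (isGaussianSubspace_span hZ h0).topologicalClosure
  simp only [Prod.exists] at this
  exact this

lemma IsGaussianRandomField.aemem_gaussianSpace [IsProbabilityMeasure P]
    (hX : IsGaussianRandomField I r X P) (p : M) (j : Fin k) :
    AEMem (gaussianSpace X P) (fun w => X p w j) := by
  have h1 : MemLp (fun w => X p w j) 2 P :=
    ((hX.gaussian.hasGaussianLaw_eval p).map_fun
      (EuclideanSpace.proj j : EuclideanSpace ℝ (Fin k) →L[ℝ] ℝ)).memLp_two
  exact ⟨h1.toLp, Submodule.le_topologicalClosure _ (Submodule.subset_span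
    ⟨p, j, h1.coeFn_toLp⟩), h1.coeFn_toLp.symm⟩

open Classical in
variable (I r X) in
/-- The sample path of a random field, replaced by zero where it fails to be of class `C^r`. -/
def samplePath (w : Ω) : C^r⟮I, M; 𝓘(ℝ, EuclideanSpace ℝ (Fin k)), EuclideanSpace ℝ (Fin k)⟯ :=
  if h : ContMDiff I 𝓘(ℝ, EuclideanSpace ℝ (Fin k)) r (fun p => X p w) then ⟨_, h⟩ else 0

lemma IsGaussianRandomField.ae_samplePath_eq (hX : IsGaussianRandomField I r X P) :
    ∀ᵐ w ∂P, ∀ p, samplePath I r X w p = X p w := by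
  filter_upwards [hX.ae_contMDiff] with w hw p
  have h : samplePath I r X w = ⟨fun p => X p w, hw⟩ := dif_pos hw
  rw [h]
  rfl

lemma IsGaussianRandomField.fieldSupport_eq (hX : IsGaussianRandomField I r X P) :
    fieldSupport I r X P = {f | ∀ U ∈ 𝓝 f, 0 < P {w | samplePath I r X w ∈ U}} := by
  ext f
  refine forall₂_congr fun U _ => ?_
  rw [measure_congr]
  filter_upwards [hX.ae_samplePath_eq] with w hw
  refine propext ⟨fun ⟨g, hgU, hg⟩ => ?_, fun h => ⟨_, h, hw⟩⟩
  have : samplePath I r X w = g := by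
    ext1 p
    rw [hw, hg]
  change samplePath I r X w ∈ U
  rwa [this]

variable [IsProbabilityMeasure P]

lemma IsGaussianRandomField.aemem_samplePath (hX : IsGaussianRandomField I r X P) (p : M)
    (ℓ : StrongDual ℝ (EuclideanSpace ℝ (Fin k))) :
    AEMem (gaussianSpace X P) (fun w => ℓ (samplePath I r X w p)) := by
  have h1 : AEMem (gaussianSpace X P)
      (fun w => ∑ j, ℓ (EuclideanSpace.single j 1) * X p w j) :=
    AEMem.sum _ fun j _ => (hX.aemem_gaussianSpace p j).const_mul _
  refine h1.congr ?_
  filter_upwards [hX.ae_samplePath_eq] with w hw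
  rw [hw]
  conv_lhs => rw [← (EuclideanSpace.basisFun (Fin k) ℝ).sum_repr (X p w), map_sum]
  refine Finset.sum_congr rfl fun j _ => ?_
  rw [map_smul, smul_eq_mul, mul_comm]
  simp

variable [FiniteDimensional ℝ E]

lemma IsGaussianRandomField.aemem_deriv_samplePath (hX : IsGaussianRandomField I r X P)
    (a : ChartJet I M r) (x : a.carrier)
    (ℓ : StrongDual ℝ (E [×a.order]→L[ℝ] EuclideanSpace ℝ (Fin k))) :
    AEMem (gaussianSpace X P) (fun w => ℓ (a.deriv (samplePath I r X w) x)) :=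
  aemem_dual_iteratedFDerivWithin hX.isGaussianSubspace gaussianSpace_isClosed
    (uniqueDiffOn_extend_target I a.chart) (extend_target_subset_closure_interior I a.chart)
    (φ := fun w => samplePath I r X w ∘ (a.chart.extend I).symm)
    (fun w => contDiffOn_comp_extend_symm a.chart_mem (samplePath I r X w).contMDiff)
    (fun _ _ ℓ => hX.aemem_samplePath _ ℓ) a.order a.order_le x (a.subset_target x.2) ℓ

lemma IsGaussianRandomField.aestronglyMeasurable_deriv_samplePath
    (hX : IsGaussianRandomField I r X P) (a : ChartJet I M r) :
    AEStronglyMeasurable (fun w => a.deriv (samplePath I r X w)) P :=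
  aestronglyMeasurable_continuousMap (hX.aemem_deriv_samplePath a)

lemma IsGaussianRandomField.aemem_dual_deriv_samplePath
    (hX : IsGaussianRandomField I r X P) (a : ChartJet I M r)
    (ℓ : StrongDual ℝ (NormContinuousMap a.carrier (E [×a.order]→L[ℝ] EuclideanSpace ℝ (Fin k)))) :
    AEMem (gaussianSpace X P) (fun w => ℓ (a.deriv (samplePath I r X w))) :=
  aemem_dual_continuousMap hX.isGaussianSubspace gaussianSpace_isClosed
    (hX.aemem_deriv_samplePath a) ℓ

lemma IsGaussianRandomField.memLp_deriv_samplePath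
    (hX : IsGaussianRandomField I r X P) (a : ChartJet I M r) :
    MemLp (fun w => a.deriv (samplePath I r X w)) 2 P := by
  have := secondCountableTopology_continuousMap_multilinear (V := EuclideanSpace ℝ (Fin k))
    a.carrier a.order
  have : CompleteSpace (E [×a.order]→L[ℝ] EuclideanSpace ℝ (Fin k)) := FiniteDimensional.complete ℝ _
  let _ : MeasurableSpace (NormContinuousMap a.carrier (E [×a.order]→L[ℝ] EuclideanSpace ℝ (Fin k))) := borel _
  have : BorelSpace (NormContinuousMap a.carrier (E [×a.order]→L[ℝ] EuclideanSpace ℝ (Fin k))) := ⟨rfl⟩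
  exact (hasGaussianLaw_of_aemem hX.isGaussianSubspace
    (hX.aestronglyMeasurable_deriv_samplePath a).aemeasurable
    (hX.aemem_dual_deriv_samplePath a)).memLp_two

lemma IsGaussianRandomField.integrable_smul_deriv_samplePath
    (hX : IsGaussianRandomField I r X P) (a : ChartJet I M r) (γ : Lp ℝ 2 P) :
    Integrable (fun w => γ w • a.deriv (samplePath I r X w)) P :=
  memLp_one_iff_integrable.1 ((hX.memLp_deriv_samplePath a).smul (Lp.memLp γ))

lemma IsGaussianRandomField.exists_integrable_bound
    (hX : IsGaussianRandomField I r X P) (a : ChartJet I M r) (γ : Lp ℝ 2 P) :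
    ∃ b : Ω → ℝ, Integrable b P ∧ ∀ᵐ w ∂P, ∀ x ∈ a.carrier, ‖γ w • iteratedFDerivWithin ℝ a.order
      (samplePath I r X w ∘ (a.chart.extend I).symm) (a.chart.extend I).target x‖ ≤ b w :=
  ⟨_, (hX.integrable_smul_deriv_samplePath a γ).norm, .of_forall fun w x hx =>
    (γ w • a.deriv (samplePath I r X w)).norm_coe_le_norm ⟨x, hx⟩⟩

lemma IsGaussianRandomField.hasFTaylorSeriesUpToOn_integral_samplePath
    (hX : IsGaussianRandomField I r X P) {e : OpenPartialHomeomorph M H}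
    (he : e ∈ IsManifold.maximalAtlas I ∞ M) (γ : Lp ℝ 2 P) :
    HasFTaylorSeriesUpToOn r
      (fun x => ∫ w, γ w • (samplePath I r X w ∘ (e.extend I).symm) x ∂P)
      (fun x i => ∫ w, γ w • iteratedFDerivWithin ℝ i
        (samplePath I r X w ∘ (e.extend I).symm) (e.extend I).target x ∂P)
      (e.extend I).target := by
  refine hasFTaylorSeriesUpToOn_integral (uniqueDiffOn_extend_target I e)
    (fun x hx => exists_compact_convex_nhdsWithin_extend_target I e hx)
    (fun w => contDiffOn_comp_extend_symm he (samplePath I r X w).contMDiff) ?_ ?_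
  · intro i hi x hx
    let a : ChartJet I M r :=
      ⟨e, he, i, hi, {x}, isCompact_singleton, Set.singleton_subset_iff.2 hx⟩
    exact (ContinuousMap.evalCLM ℝ (⟨x, rfl⟩ : a.carrier)).integrable_comp
      (hX.integrable_smul_deriv_samplePath a γ)
  · intro i hi K hK hKc
    exact hX.exists_integrable_bound ⟨e, he, i, hi, K, hKc, hK⟩ γ

omit [FiniteDimensional ℝ E] in
lemma IsGaussianRandomField.cameronMartinFun_eq_integral (hX : IsGaussianRandomField I r X P)
    (γ : Lp ℝ 2 P) (q : M) :
    cameronMartinFun X P γ q = ∫ w, γ w • samplePath I r X w q ∂P := by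
  ext i
  rw [eval_integral_piLp]
  · refine integral_congr_ae ?_
    filter_upwards [hX.ae_samplePath_eq] with w hw
    rw [PiLp.smul_apply, hw, smul_eq_mul, mul_comm]
  · intro i
    exact (hX.aemem_samplePath q (EuclideanSpace.proj i)).memLp.integrable_mul (Lp.memLp γ) |>.congr
      (.of_forall fun w => mul_comm _ _)

/-- The function `ρ_X(γ)` is of class `C^r` for every square integrable `γ`. -/
lemma IsGaussianRandomField.contMDiff_cameronMartinFun [IsManifold I ∞ M]
    (hX : IsGaussianRandomField I r X P) (γ : Lp ℝ 2 P) :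
    ContMDiff I 𝓘(ℝ, EuclideanSpace ℝ (Fin k)) r (cameronMartinFun X P γ) := by
  refine contMDiff_of_forall_maximalAtlas fun e he => ?_
  have h := (hX.hasFTaylorSeriesUpToOn_integral_samplePath he γ).contDiffOn
  refine ContDiffOn.congr h fun x _ => ?_
  exact hX.cameronMartinFun_eq_integral γ _

lemma IsGaussianRandomField.deriv_cameronMartinFun (hX : IsGaussianRandomField I r X P)
    (a : ChartJet I M r) (γ : Lp ℝ 2 P)
    (f : C^r⟮I, M; 𝓘(ℝ, EuclideanSpace ℝ (Fin k)), EuclideanSpace ℝ (Fin k)⟯)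
    (hf : ∀ q, f q = cameronMartinFun X P γ q) :
    a.deriv f = ∫ w, γ w • a.deriv (samplePath I r X w) ∂P := by
  ext1 x
  have hx := a.subset_target x.2
  have : CompleteSpace (E [×a.order]→L[ℝ] EuclideanSpace ℝ (Fin k)) := FiniteDimensional.complete ℝ _
  rw [ContinuousMap.integral_apply (hX.integrable_smul_deriv_samplePath a γ), a.deriv_apply]
  have h1 := (hX.hasFTaylorSeriesUpToOn_integral_samplePath
    a.chart_mem γ).eq_iteratedFDerivWithin_of_uniqueDiffOn (m := a.order)
    (mod_cast a.order_le) (uniqueDiffOn_extend_target I a.chart) hx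
  have h2 : (f ∘ (a.chart.extend I).symm) =
      fun x => ∫ w, γ w • (samplePath I r X w ∘ (a.chart.extend I).symm) x ∂P := by
    funext x
    exact (hf _).trans (hX.cameronMartinFun_eq_integral γ _)
  rw [h2]
  exact h1.symm

variable (I M r k) in
/-- The continuous functionals on `C^r(M, ℝ^k)` that factor through finitely many restricted
derivatives in charts. -/
def jetDual : Submodule ℝ
    (C^r⟮I, M; 𝓘(ℝ, EuclideanSpace ℝ (Fin k)), EuclideanSpace ℝ (Fin k)⟯ →ₗ[ℝ] ℝ) :=
  Submodule.span ℝ {ℓ | ∃ (a : ChartJet I M r)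
    (m : StrongDual ℝ (NormContinuousMap a.carrier (E [×a.order]→L[ℝ] EuclideanSpace ℝ (Fin k)))),
      ∀ f, ℓ f = m (a.deriv f)}

omit [FiniteDimensional ℝ E] in
lemma continuous_of_mem_jetDual
    {ℓ : C^r⟮I, M; 𝓘(ℝ, EuclideanSpace ℝ (Fin k)), EuclideanSpace ℝ (Fin k)⟯ →ₗ[ℝ] ℝ}
    (hℓ : ℓ ∈ jetDual I M k r) : Continuous ℓ := by
  induction hℓ using Submodule.span_induction with
  | mem ℓ h =>
    obtain ⟨a, m, h⟩ := h
    have h1 : Continuous (a.deriv (V := EuclideanSpace ℝ (Fin k))) := by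
      rw [weakWhitneyTopology_eq_iInf]
      exact continuous_iInf_dom continuous_induced_dom
    exact (m.continuous.comp h1).congr fun f => (h f).symm
  | zero => exact continuous_const
  | add ℓ m _ _ h1 h2 => exact h1.add h2
  | smul c ℓ _ h => exact h.const_smul c

lemma IsGaussianRandomField.aemem_of_mem_jetDual (hX : IsGaussianRandomField I r X P)
    {ℓ : C^r⟮I, M; 𝓘(ℝ, EuclideanSpace ℝ (Fin k)), EuclideanSpace ℝ (Fin k)⟯ →ₗ[ℝ] ℝ}
    (hℓ : ℓ ∈ jetDual I M k r) :
    AEMem (gaussianSpace X P) (fun w => ℓ (samplePath I r X w)) := by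
  induction hℓ using Submodule.span_induction with
  | mem ℓ h =>
    obtain ⟨a, m, h⟩ := h
    simp only [h]
    exact hX.aemem_dual_deriv_samplePath a m
  | zero => exact AEMem.zero
  | add ℓ m _ _ h1 h2 => exact h1.add h2
  | smul c ℓ _ h => exact h.const_mul c

lemma IsGaussianRandomField.apply_cameronMartinFun (hX : IsGaussianRandomField I r X P)
    {ℓ : C^r⟮I, M; 𝓘(ℝ, EuclideanSpace ℝ (Fin k)), EuclideanSpace ℝ (Fin k)⟯ →ₗ[ℝ] ℝ}
    (hℓ : ℓ ∈ jetDual I M k r) (γ : Lp ℝ 2 P)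
    (f : C^r⟮I, M; 𝓘(ℝ, EuclideanSpace ℝ (Fin k)), EuclideanSpace ℝ (Fin k)⟯)
    (hf : ∀ q, f q = cameronMartinFun X P γ q) :
    ℓ f = ∫ w, γ w * ℓ (samplePath I r X w) ∂P := by
  have hint : ∀ ℓ ∈ jetDual I M k r,
      Integrable (fun w => γ w * ℓ (samplePath I r X w)) P := fun ℓ hℓ =>
    (Lp.memLp γ).integrable_mul (hX.aemem_of_mem_jetDual hℓ).memLp
  induction hℓ using Submodule.span_induction with
  | mem ℓ h =>
    obtain ⟨a, m, h⟩ := h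
    have : CompleteSpace (E [×a.order]→L[ℝ] EuclideanSpace ℝ (Fin k)) :=
      FiniteDimensional.complete ℝ _
    rw [h, hX.deriv_cameronMartinFun a γ f hf,
      ← m.integral_comp_comm (hX.integrable_smul_deriv_samplePath a γ)]
    simp [h]
  | zero => simp
  | add ℓ m h1 h2 h3 h4 =>
    simp only [LinearMap.add_apply, mul_add]
    rw [integral_add (hint ℓ h1) (hint m h2), h3, h4]
  | smul c ℓ h1 h2 =>
    simp only [LinearMap.smul_apply, smul_eq_mul]
    rw [h2, ← integral_const_mul]
    refine integral_congr_ae (.of_forall fun w => ?_)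
    ring

theorem IsGaussianRandomField.fieldSupport_eq_closure (hX : IsGaussianRandomField I r X P)
    (S : Submodule ℝ C^r⟮I, M; 𝓘(ℝ, EuclideanSpace ℝ (Fin k)), EuclideanSpace ℝ (Fin k)⟯)
    (hS : ∀ ℓ ∈ jetDual I M k r,
      (∀ᵐ w ∂P, ℓ (samplePath I r X w) = 0) ↔ ∀ s ∈ S, ℓ s = 0) :
    fieldSupport I r X P =
      closure (S : Set C^r⟮I, M; 𝓘(ℝ, EuclideanSpace ℝ (Fin k)), EuclideanSpace ℝ (Fin k)⟯) := by
  have (a : ChartJet I M r) := secondCountableTopology_continuousMap_multilinear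
    (V := EuclideanSpace ℝ (Fin k)) a.carrier a.order
  have (a : ChartJet I M r) : CompleteSpace (E [×a.order]→L[ℝ] EuclideanSpace ℝ (Fin k)) :=
    FiniteDimensional.complete ℝ _
  rw [hX.fieldSupport_eq]
  exact setOf_forall_nhds_pos_eq_closure
    (B := fun a : ChartJet I M r =>
      NormContinuousMap a.carrier (E [×a.order]→L[ℝ] EuclideanSpace ℝ (Fin k)))
    (fun a : ChartJet I M r => a.deriv)
    weakWhitneyTopology_eq_iInf hX.isGaussianSubspace (samplePath I r X)
    hX.aestronglyMeasurable_deriv_samplePath hX.aemem_dual_deriv_samplePath S hS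

end RandomField

section Descriptions

variable {E : Type*} [NormedAddCommGroup E] [NormedSpace ℝ E] [FiniteDimensional ℝ E]
  {H : Type*} [TopologicalSpace H] {I : ModelWithCorners ℝ E H}
  {M : Type*} [TopologicalSpace M] [ChartedSpace H M]
  {Ω : Type*} [MeasurableSpace Ω] {P : Measure Ω} [IsProbabilityMeasure P] {k : ℕ} {r : ℕ∞}
  {X : M → Ω → EuclideanSpace ℝ (Fin k)}

omit [TopologicalSpace M] [IsProbabilityMeasure P] in
lemma covColumn_eq_cameronMartinFun {p : M} {j : Fin k} {γ : Lp ℝ 2 P}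
    (hγ : γ =ᵐ[P] fun w => X p w j) : covColumn X P p j = cameronMartinFun X P γ := by
  funext q
  refine congrArg (WithLp.toLp 2) (funext fun i => ?_)
  refine integral_congr_ae ?_
  filter_upwards [hγ] with w hw
  rw [hw]

omit [IsProbabilityMeasure P] in
lemma integral_mul_self_eq_zero_iff {γ : Lp ℝ 2 P} :
    ∫ w, γ w * γ w ∂P = 0 ↔ γ = 0 := by
  have h : ∫ w, γ w * γ w ∂P = inner ℝ γ γ := by
    rw [L2.inner_def]
    rfl
  rw [h, inner_self_eq_zero]

lemma IsGaussianRandomField.contMDiff_covColumn [IsManifold I ∞ M]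
    (hX : IsGaussianRandomField I r X P) (p : M) (j : Fin k) :
    ContMDiff I 𝓘(ℝ, EuclideanSpace ℝ (Fin k)) r (covColumn X P p j) := by
  obtain ⟨γ, -, h⟩ := hX.aemem_gaussianSpace p j
  rw [covColumn_eq_cameronMartinFun h.symm]
  exact hX.contMDiff_cameronMartinFun γ

lemma IsGaussianRandomField.apply_cameronMartinFun_eq_zero (hX : IsGaussianRandomField I r X P)
    {ℓ : C^r⟮I, M; 𝓘(ℝ, EuclideanSpace ℝ (Fin k)), EuclideanSpace ℝ (Fin k)⟯ →ₗ[ℝ] ℝ}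
    (hℓ : ℓ ∈ jetDual I M k r) (h0 : ∀ᵐ w ∂P, ℓ (samplePath I r X w) = 0) (γ : Lp ℝ 2 P)
    (f : C^r⟮I, M; 𝓘(ℝ, EuclideanSpace ℝ (Fin k)), EuclideanSpace ℝ (Fin k)⟯)
    (hf : ∀ q, f q = cameronMartinFun X P γ q) : ℓ f = 0 := by
  rw [hX.apply_cameronMartinFun hℓ γ f hf]
  refine integral_eq_zero_of_ae ?_
  filter_upwards [h0] with w hw
  rw [hw, mul_zero]
  rfl

theorem IsGaussianRandomField.fieldSupport_eq_closure_span_covColumn [IsManifold I ∞ M]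
    (hX : IsGaussianRandomField I r X P) :
    fieldSupport I r X P = closure (Submodule.span ℝ
      {f : C^r⟮I, M; 𝓘(ℝ, EuclideanSpace ℝ (Fin k)), EuclideanSpace ℝ (Fin k)⟯ |
        ∃ (p : M) (j : Fin k), ∀ q, f q = covColumn X P p j q} :
      Set C^r⟮I, M; 𝓘(ℝ, EuclideanSpace ℝ (Fin k)), EuclideanSpace ℝ (Fin k)⟯) := by
  refine hX.fieldSupport_eq_closure _ fun ℓ hℓ => ⟨fun h0 s hs => ?_, fun h0 => ?_⟩
  · induction hs using Submodule.span_induction with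
    | mem f hf =>
      obtain ⟨p, j, hf⟩ := hf
      obtain ⟨γ, -, h⟩ := hX.aemem_gaussianSpace p j
      rw [covColumn_eq_cameronMartinFun h.symm] at hf
      exact hX.apply_cameronMartinFun_eq_zero hℓ h0 γ f hf
    | zero => exact map_zero ℓ
    | add x y _ _ hx hy => rw [map_add, hx, hy, add_zero]
    | smul c x _ hx => rw [map_smul, hx, smul_zero]
  · obtain ⟨γ, hγ, e⟩ := hX.aemem_of_mem_jetDual hℓ
    have hle : gaussianSpace X P ≤ (Submodule.span ℝ {γ})ᗮ := by
      refine Submodule.topologicalClosure_minimal _ ?_ (Submodule.isClosed_orthogonal _)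
      refine Submodule.span_le.2 ?_
      rintro δ ⟨p, j, hδ⟩
      refine Submodule.mem_orthogonal_singleton_iff_inner_left.2 ?_
      obtain ⟨g, hg⟩ : ∃ g : C^r⟮I, M; 𝓘(ℝ, EuclideanSpace ℝ (Fin k)), EuclideanSpace ℝ (Fin k)⟯,
          ∀ q, g q = covColumn X P p j q := ⟨⟨_, hX.contMDiff_covColumn p j⟩, fun _ => rfl⟩
      have h1 := h0 g (Submodule.subset_span ⟨p, j, hg⟩)
      rw [covColumn_eq_cameronMartinFun hδ] at hg
      rw [hX.apply_cameronMartinFun hℓ δ g hg] at h1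
      rw [L2.inner_def, ← h1]
      refine integral_congr_ae ?_
      filter_upwards [e] with w hw
      rw [hw]
      exact mul_comm _ _
    have hz : γ = 0 := inner_self_eq_zero.1
      (Submodule.mem_orthogonal_singleton_iff_inner_left.1 (hle hγ))
    filter_upwards [e, Lp.coeFn_zero ℝ 2 P] with w hw h0w
    rw [hw, hz, h0w]
    rfl

variable (I r X P) in
/-- The Cameron–Martin space of a random field as a linear subspace. -/
def cameronMartinSubmodule (hX : IsGaussianRandomField I r X P) :
    Submodule ℝ C^r⟮I, M; 𝓘(ℝ, EuclideanSpace ℝ (Fin k)), EuclideanSpace ℝ (Fin k)⟯ :=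
  have hint : ∀ (q : M) (γ : Lp ℝ 2 P),
      Integrable (fun w => γ w • samplePath I r X w q) P := fun q γ =>
    Integrable.of_eval_piLp fun i =>
      (Lp.memLp γ).integrable_mul (hX.aemem_samplePath q (EuclideanSpace.proj i)).memLp
  { carrier := cameronMartinSpace I r X P
    zero_mem' := ⟨0, Submodule.zero_mem _, fun q => by
      rw [hX.cameronMartinFun_eq_integral, integral_eq_zero_of_ae]
      · rfl
      · filter_upwards [Lp.coeFn_zero ℝ 2 P] with w hw
        rw [hw]
        exact zero_smul _ _⟩
    add_mem' := by
      rintro f g ⟨γ, hγ, hf⟩ ⟨δ, hδ, hg⟩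
      refine ⟨γ + δ, Submodule.add_mem _ hγ hδ, fun q => ?_⟩
      rw [ContMDiffMap.coe_add, Pi.add_apply, hf, hg, hX.cameronMartinFun_eq_integral,
        hX.cameronMartinFun_eq_integral, hX.cameronMartinFun_eq_integral,
        ← integral_add (hint q γ) (hint q δ)]
      refine integral_congr_ae ?_
      filter_upwards [Lp.coeFn_add γ δ] with w hw
      rw [hw, Pi.add_apply, add_smul]
    smul_mem' := by
      rintro c f ⟨γ, hγ, hf⟩
      refine ⟨c • γ, Submodule.smul_mem _ c hγ, fun q => ?_⟩
      rw [ContMDiffMap.coe_smul, Pi.smul_apply, hf, hX.cameronMartinFun_eq_integral,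
        hX.cameronMartinFun_eq_integral, ← integral_smul]
      refine integral_congr_ae ?_
      filter_upwards [Lp.coeFn_smul c γ] with w hw
      rw [hw, Pi.smul_apply, smul_assoc] }

theorem IsGaussianRandomField.fieldSupport_eq_closure_cameronMartinSpace [IsManifold I ∞ M]
    (hX : IsGaussianRandomField I r X P) :
    fieldSupport I r X P = closure (cameronMartinSpace I r X P) := by
  refine hX.fieldSupport_eq_closure (cameronMartinSubmodule I P r X hX)
    fun ℓ hℓ => ⟨fun h0 s hs => ?_, fun h0 => ?_⟩
  · obtain ⟨γ, -, hs⟩ := hs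
    exact hX.apply_cameronMartinFun_eq_zero hℓ h0 γ s hs
  · obtain ⟨γ, hγ, e⟩ := hX.aemem_of_mem_jetDual hℓ
    obtain ⟨g, hg⟩ : ∃ g : C^r⟮I, M; 𝓘(ℝ, EuclideanSpace ℝ (Fin k)), EuclideanSpace ℝ (Fin k)⟯,
        ∀ q, g q = cameronMartinFun X P γ q := ⟨⟨_, hX.contMDiff_cameronMartinFun γ⟩, fun _ => rfl⟩
    have h1 := h0 g ⟨γ, hγ, hg⟩
    rw [hX.apply_cameronMartinFun hℓ γ g hg] at h1
    have hz : γ = 0 := by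
      rw [← integral_mul_self_eq_zero_iff, ← h1]
      refine integral_congr_ae ?_
      filter_upwards [e] with w hw
      rw [hw]
    filter_upwards [e, Lp.coeFn_zero ℝ 2 P] with w hw h0w
    rw [hw, hz, h0w]
    rfl

theorem IsGaussianRandomField.fieldSupport_eq_closure_span_range
    (hX : IsGaussianRandomField I r X P)
    {f : ℕ → C^r⟮I, M; 𝓘(ℝ, EuclideanSpace ℝ (Fin k)), EuclideanSpace ℝ (Fin k)⟯}
    {ξ : ℕ → Ω → ℝ} (hξ : ∀ n, HasLaw (ξ n) (gaussianReal 0 1) P) (hi : iIndepFun ξ P)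
    (h : ∀ᵐ w ∂P, ∃ g : C^r⟮I, M; 𝓘(ℝ, EuclideanSpace ℝ (Fin k)), EuclideanSpace ℝ (Fin k)⟯,
      (∀ p, g p = X p w) ∧
      Tendsto (fun N => ∑ n ∈ Finset.range N, ξ n w • f n) atTop (𝓝 g)) :
    fieldSupport I r X P = closure (Submodule.span ℝ (Set.range f) :
      Set C^r⟮I, M; 𝓘(ℝ, EuclideanSpace ℝ (Fin k)), EuclideanSpace ℝ (Fin k)⟯) := by
  have hlim : ∀ ℓ ∈ jetDual I M k r, ∀ᵐ w ∂P, Tendsto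
      (fun N => ∑ n ∈ Finset.range N, ℓ (f n) * ξ n w) atTop (𝓝 (ℓ (samplePath I r X w))) := by
    intro ℓ hℓ
    filter_upwards [h, hX.ae_samplePath_eq] with w ⟨g, hg, ht⟩ hw
    have e : samplePath I r X w = g := by
      ext1 p
      rw [hw, hg]
    rw [e]
    refine (((continuous_of_mem_jetDual hℓ).tendsto g).comp ht).congr fun N => ?_
    simp only [Function.comp_apply, map_sum, map_smul, smul_eq_mul, mul_comm]
  refine hX.fieldSupport_eq_closure _ fun ℓ hℓ => ⟨fun h0 s hs => ?_, fun h0 => ?_⟩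
  · have hz : ∀ n, ℓ (f n) = 0 := by
      refine eq_zero_of_tendsto_sum_mul_gaussian hξ hi (a := fun n => ℓ (f n)) ?_
      filter_upwards [hlim ℓ hℓ, h0] with w hw h0w
      rwa [h0w] at hw
    have hle : Submodule.span ℝ (Set.range f) ≤ LinearMap.ker ℓ :=
      Submodule.span_le.2 (by rintro _ ⟨n, rfl⟩; exact hz n)
    exact hle hs
  · filter_upwards [hlim ℓ hℓ] with w hw
    have hz : ∀ n, ℓ (f n) = 0 := fun n => h0 _ (Submodule.subset_span ⟨n, rfl⟩)
    simp only [hz, zero_mul, Finset.sum_const_zero] at hw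
    exact tendsto_nhds_unique hw tendsto_const_nhds

end Descriptions

end GaussianRandomField

end

theorem theorem2p1p3
    {E : Type*} [NormedAddCommGroup E] [NormedSpace ℝ E] [FiniteDimensional ℝ E]
    {H : Type*} [TopologicalSpace H] (I : ModelWithCorners ℝ E H)
    {M : Type*} [TopologicalSpace M] [ChartedSpace H M] [IsManifold I ∞ M]
    [T2Space M] [SecondCountableTopology M]
    {Ω : Type*} [MeasurableSpace Ω] (P : Measure Ω) [IsProbabilityMeasure P]
    {k : ℕ} (r : ℕ∞) (X : M → Ω → EuclideanSpace ℝ (Fin k))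
    (hX : GaussianRandomField.IsGaussianRandomField I r X P) :
    -- the functions `h_p^j` belong to `C^r(M, ℝ^k)` and the closure of their span is the support
    ((∀ (p : M) (j : Fin k),
        ContMDiff I 𝓘(ℝ, EuclideanSpace ℝ (Fin k)) r (GaussianRandomField.covColumn X P p j)) ∧
      GaussianRandomField.fieldSupport I r X P =
        closure (Submodule.span ℝ
          {f : C^r⟮I, M; 𝓘(ℝ, EuclideanSpace ℝ (Fin k)), EuclideanSpace ℝ (Fin k)⟯ |
            ∃ (p : M) (j : Fin k), ∀ q, f q = GaussianRandomField.covColumn X P p j q} :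
          Set C^r⟮I, M; 𝓘(ℝ, EuclideanSpace ℝ (Fin k)), EuclideanSpace ℝ (Fin k)⟯)) ∧
    -- `ρ_X` maps `Γ_X` into `C^r(M, ℝ^k)` and the closure of its image is the support
    ((∀ γ ∈ GaussianRandomField.gaussianSpace X P,
        ContMDiff I 𝓘(ℝ, EuclideanSpace ℝ (Fin k)) r
          (GaussianRandomField.cameronMartinFun X P γ)) ∧
      GaussianRandomField.fieldSupport I r X P =
        closure (GaussianRandomField.cameronMartinSpace I r X P)) ∧
    -- the support in terms of an arbitrary almost surely convergent Gaussian expansion of `X`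
    (∀ (f : ℕ → C^r⟮I, M; 𝓘(ℝ, EuclideanSpace ℝ (Fin k)), EuclideanSpace ℝ (Fin k)⟯)
        (ξ : ℕ → Ω → ℝ),
        (∀ n, HasLaw (ξ n) (gaussianReal 0 1) P) → iIndepFun ξ P →
        (∀ᵐ w ∂P, ∃ g : C^r⟮I, M; 𝓘(ℝ, EuclideanSpace ℝ (Fin k)), EuclideanSpace ℝ (Fin k)⟯,
          (∀ p, g p = X p w) ∧
          Tendsto (fun N => ∑ n ∈ Finset.range N, ξ n w • f n) atTop (𝓝 g)) →
        GaussianRandomField.fieldSupport I r X P =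
          closure (Submodule.span ℝ (Set.range f) :
            Set C^r⟮I, M; 𝓘(ℝ, EuclideanSpace ℝ (Fin k)), EuclideanSpace ℝ (Fin k)⟯)) := by
  exact ⟨⟨hX.contMDiff_covColumn, hX.fieldSupport_eq_closure_span_covColumn⟩,
    ⟨fun γ _ => hX.contMDiff_cameronMartinFun γ, hX.fieldSupport_eq_closure_cameronMartinSpace⟩,
    fun _ _ hξ hi h => hX.fieldSupport_eq_closure_span_range hξ hi h⟩
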